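/- Consider a position auction with $n$ agents and $k$ positions, $1\le k<n$, and let $\alpha,\beta\in\mathbb{R}^k$ be vectors with positive, non-increasing entries; put $\alpha_j=\beta_j=0$ for $j>k$. Agents' values $v_1,\dots,v_n$ are drawn independently from a distribution $\mu$ on $\mathbb{R}$ with probability density function $f$, cumulative distribution function $F$ and support $[0,\bar v]$, $0<\bar v<\infty$. In the $\alpha$-VCG mechanism agents submit bids $b_1,\dots,b_n\ge 0$, positions $g_i(b)\in\{1,\dots,n\}$ are assigned one-to-one in non-increasing order of the bids, with ties broken by an arbitrary (measurable) rule depending only on the bids, and agent $i$ pays $p_i(b)=\sum_{j=g_i(b)}^{k}(\alpha_j-\alpha_{j+1})\,b_{(j+1)}$, where $b_{(1)}\ge\dots\ge b_{(n)}$ are the ordered bids. The utility of agent $i$ is $\beta_{g_i(b)}v_i-p_i(b)$. A profile of measurable bidding functions, one for each agent, mapping values to non-negative bids, is an efficient (Bayes-Nash) equilibrium if the resulting allocation maximizes $\sum_i\beta_{g_i}v_i$ for almost every value profile, and for every agent $i$ and almost every value $v_i$ the prescribed bid maximizes the expected utility of agent $i$ over all bids $x\ge 0$, given that the other agents follow their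 bidding functions. For $s\in\{1,\dots,k\}$ let \[ P_s(v)=\binom{n-1}{s-1}(1-F(v))^{s-1}F(v)^{n-s}, \qquad b^V(v)=\frac{\sum_{s=1}^{k}\beta_s\frac{dP_s(v)}{dv}\,v}{\sum_{s=1}^{k}\alpha_s\frac{dP_s(v)}{dv}} . \] Here ``almost every(where)'' refers to the distribution $\mu$ of values, and a function is increasing almost everywhere if it is strictly increasing outside a set of values of probability zero. Then the following hold. (1) In every efficient equilibrium of the $\alpha$-VCG mechanism, every agent uses a bidding function that is equal to $b^V$ almost everywhere. (2) If $b^V$ is increasing almost everywhere, then the symmetric profile in which every agent uses $b^V$ is an efficient equilibrium, and by (1) it is the unique one up to changes on sets of values of probability zero. In this case there moreover is a function equal to $b^V$ almost everywhere which, used by every agent, yields an efficient allocation for every profile of values in $[0,\bar v)$ and an optimal bid for every value in $[0,\bar v)$; if $b^V$ is essentially bounded, the same function does so on all of $[0,\bar v]$. (3) If $b^V$ is not increasing almost everywhere, then no efficient equilibrium exists. (4) If all agents use the same measurable, almost everywhere non-negative bidding function $b$ that is increasing almost everywhere (in particular $b=b^V$ in an efficient equilibrium), then for almost every $v$ each function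 $\frac{dP_s}{dt}\,b$ is integrable on $[0,v]$ and the expected payment of an agent with value $v$ is $\sum_{s=1}^{k}\alpha_s\int_0^v\frac{dP_s(t)}{dt}\,b(t)\,dt$. -/

import Mathlib

open MeasureTheory ProbabilityTheory Set

noncomputable section

namespace PositionAuction

/-- A vector of `k` position qualities, extended by `0` to all later positions.
Positions, like agents, are numbered from `0`. -/
def ext {k : ℕ} (γ : Fin k → ℝ) (j : ℕ) : ℝ :=
  if h : j < k then γ ⟨j, h⟩ else 0

/-- The `j`-th largest entry of `b`, counted from `j = 0`, with value `0` for `j ≥ n`. -/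
def orderStat {n : ℕ} (b : Fin n → ℝ) (j : ℕ) : ℝ :=
  if h : j < n then b (Tuple.sort (fun i => -b i) ⟨j, h⟩) else 0

/-- `g b i` is the position of agent `i` at bid profile `b`. Positions are assigned in
non-increasing order of the bids; ties are broken in an arbitrary (measurable) way that depends on
the bids only. -/
structure IsAllocationRule {n : ℕ} (g : (Fin n → ℝ) → Equiv.Perm (Fin n)) : Prop where
  sorted : ∀ b i j, g b i < g b j → b j ≤ b i
  measurable : ∀ σ, MeasurableSet {b | g b = σ}

/-- The assignment `σ` of agents to positions maximizes welfare at values `v`. -/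
def IsEfficient {n k : ℕ} (β : Fin k → ℝ) (v : Fin n → ℝ) (σ : Equiv.Perm (Fin n)) : Prop :=
  ∀ τ : Equiv.Perm (Fin n), ∑ i, ext β (τ i) * v i ≤ ∑ i, ext β (σ i) * v i

/-- The payment of agent `i` in the VCG mechanism with parameters `α`. -/
def vcgPayment {n k : ℕ} (α : Fin k → ℝ) (g : (Fin n → ℝ) → Equiv.Perm (Fin n))
    (b : Fin n → ℝ) (i : Fin n) : ℝ :=
  ∑ j ∈ Finset.Ico (g b i : ℕ) k, (ext α j - ext α (j + 1)) * orderStat b (j + 1)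

/-- The utility of agent `i` with value `vi` at bid profile `b`. -/
def utility {n k : ℕ} (α β : Fin k → ℝ) (g : (Fin n → ℝ) → Equiv.Perm (Fin n))
    (b : Fin n → ℝ) (i : Fin n) (vi : ℝ) : ℝ :=
  ext β (g b i) * vi - vcgPayment α g b i

/-- The profile of bids when agent `i` bids `x` and every other agent `j` has value `w j` and uses
the bidding function `b j`. -/
def bids {n : ℕ} (b : Fin n → ℝ → ℝ) (i : Fin n) (x : ℝ) (w : Fin n → ℝ) : Fin n → ℝ :=
  Function.update (fun j => b j (w j)) i x

/-- The expected payment of agent `i` when it bids `x`. The values of the other agents are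
independent with law `μ`; the coordinate `i` of `w` is not used. -/
def expectedPayment {n k : ℕ} (μ : Measure ℝ) (α : Fin k → ℝ)
    (g : (Fin n → ℝ) → Equiv.Perm (Fin n)) (b : Fin n → ℝ → ℝ) (i : Fin n) (x : ℝ) : ℝ :=
  ∫ w, vcgPayment α g (bids b i x w) i ∂(Measure.pi fun _ : Fin n => μ)

/-- The expected utility of agent `i` with value `vi` when it bids `x`. -/
def expectedUtility {n k : ℕ} (μ : Measure ℝ) (α β : Fin k → ℝ)
    (g : (Fin n → ℝ) → Equiv.Perm (Fin n)) (b : Fin n → ℝ → ℝ) (i : Fin n) (x vi : ℝ) : ℝ :=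
  ∫ w, utility α β g (bids b i x w) i vi ∂(Measure.pi fun _ : Fin n => μ)

/-- The (not necessarily symmetric) profile `b` of bidding functions, with non-negative bids, is an
efficient Bayes-Nash equilibrium: the allocation is efficient for almost every value profile, and
for almost every value of every agent the bid is optimal. -/
structure IsEfficientEquilibrium {n k : ℕ} (μ : Measure ℝ) (α β : Fin k → ℝ)
    (g : (Fin n → ℝ) → Equiv.Perm (Fin n)) (b : Fin n → ℝ → ℝ) : Prop where
  measurable : ∀ i, Measurable (b i)
  nonneg : ∀ i, ∀ᵐ v ∂μ, 0 ≤ b i v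
  efficient : ∀ᵐ v ∂(Measure.pi fun _ : Fin n => μ), IsEfficient β v (g fun i => b i (v i))
  best_response : ∀ i, ∀ᵐ v ∂μ, ∀ x, 0 ≤ x →
    expectedUtility μ α β g b i x v ≤ expectedUtility μ α β g b i (b i v) v

/-- The symmetric profile given by `b` is an efficient Bayes-Nash equilibrium without exceptional
values in `T`: the allocation is efficient for every profile of values in `T`, and the bid is
optimal for every value in `T`. -/
structure IsEfficientEquilibriumOn {n k : ℕ} (T : Set ℝ) (μ : Measure ℝ) (α β : Fin k → ℝ)
    (g : (Fin n → ℝ) → Equiv.Perm (Fin n)) (b : ℝ → ℝ) : Prop where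
  measurable : Measurable b
  nonneg : ∀ v ∈ T, 0 ≤ b v
  efficient : ∀ v : Fin n → ℝ, (∀ i, v i ∈ T) → IsEfficient β v (g fun i => b (v i))
  best_response : ∀ i : Fin n, ∀ v ∈ T, ∀ x, 0 ≤ x →
    expectedUtility μ α β g (fun _ => b) i x v ≤ expectedUtility μ α β g (fun _ => b) i (b v) v

/-- `b` is (strictly) increasing outside a set of values of probability zero. -/
def IncreasingAE (μ : Measure ℝ) (b : ℝ → ℝ) : Prop :=
  ∃ N : Set ℝ, μ N = 0 ∧ StrictMonoOn b Nᶜ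

/-- The probability that exactly `s` of `n - 1` independent values exceed `v`, i.e. that an agent
with value `v` is assigned position `s` (counted from `0`) in an efficient allocation. -/
def posProb (μ : Measure ℝ) (n s : ℕ) (v : ℝ) : ℝ :=
  ((n - 1).choose s : ℝ) * (1 - cdf μ v) ^ s * (cdf μ v) ^ (n - 1 - s)

/-- The candidate bidding function. -/
def candidateBid {k : ℕ} (μ : Measure ℝ) (n : ℕ) (α β : Fin k → ℝ) (v : ℝ) : ℝ :=
  (∑ s : Fin k, β s * deriv (posProb μ n s) v * v) / (∑ s : Fin k, α s * deriv (posProb μ n s) v)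

end PositionAuction

end

/-!
If the others bid by a function that is increasing in the value, then a bid amounts to a threshold:
an agent outbids exactly the rivals with a value below some `t`. The agent's quality and payment
are sums over these rivals, and conditioning on the value of each of them turns the expected quality
and the expected payment into integrals `∫ y in Iio t, Q_β y ∂μ` and `∫ y in Iio t, b y * Q_α y ∂μ`,
where the density `Q_γ` (`marginalQuality`) depends on the distribution function alone. Efficiency
forces all agents to use one and the same increasing function, up to null sets. Comparing the bids
of two nearby values then squeezes `b v * Q_α v` between values of `y * Q_β y` near `v`, and
continuity of `Q_α` and `Q_β` yields `b v = v * Q_β v / Q_α v`. Conversely, for this `b` the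
expected utility of the threshold `t` is `∫ y in Iio t, (v - y) * Q_β y ∂μ`, which is largest at
`t = v`.
-/

open scoped Finset

noncomputable section

namespace PositionAuction

section Qualities

variable {k : ℕ} {γ : Fin k → ℝ}

theorem ext_of_lt {j : ℕ} (hj : j < k) : ext γ j = γ ⟨j, hj⟩ := dif_pos hj

theorem ext_of_le {j : ℕ} (hj : k ≤ j) : ext γ j = 0 := dif_neg hj.not_gt

theorem ext_pos_iff (hγ : ∀ j, 0 < γ j) {j : ℕ} : 0 < ext γ j ↔ j < k := by
  rcases lt_or_ge j k with hj | hj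
  · simp [ext_of_lt hj, hγ, hj]
  · simp [ext_of_le hj, hj]

theorem antitone_ext (hγ : Antitone γ) (hγ0 : ∀ j, 0 < γ j) : Antitone (ext γ) := by
  intro a b hab
  rcases lt_or_ge b k with hb | hb
  · rw [ext_of_lt hb, ext_of_lt (hab.trans_lt hb)]
    exact hγ hab
  · rw [ext_of_le hb]
    rcases lt_or_ge a k with ha | ha
    · exact ((ext_pos_iff hγ0).2 ha).le
    · rw [ext_of_le ha]

/-- The loss of quality from position `j` to position `j + 1`. It is the weight of the bid
`b_(j+1)` in the VCG payments. -/
def decrement (γ : Fin k → ℝ) (j : ℕ) : ℝ :=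
  ext γ j - ext γ (j + 1)

theorem decrement_nonneg (hγ : Antitone γ) (hγ0 : ∀ j, 0 < γ j) (j : ℕ) : 0 ≤ decrement γ j :=
  sub_nonneg.2 (antitone_ext hγ hγ0 j.le_succ)

theorem decrement_of_le {j : ℕ} (hj : k ≤ j) : decrement γ j = 0 := by
  rw [decrement, ext_of_le hj, ext_of_le (hj.trans j.le_succ), sub_zero]

theorem sum_Ico_decrement (γ : Fin k → ℝ) (a : ℕ) :
    ∑ j ∈ Finset.Ico a k, decrement γ j = ext γ a := by
  rcases le_or_gt a k with ha | ha
  · rw [← neg_inj, ← Finset.sum_neg_distrib]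
    simp only [decrement, neg_sub]
    rw [Finset.sum_Ico_sub _ ha, ext_of_le le_rfl, zero_sub]
  · rw [Finset.Ico_eq_empty (not_lt_of_gt ha), Finset.sum_empty, ext_of_le ha.le]

end Qualities

section Allocation

variable {n : ℕ} {g : (Fin n → ℝ) → Equiv.Perm (Fin n)}

theorem card_perm_lt (σ : Equiv.Perm (Fin n)) (a : Fin n) : #{i | σ i < a} = (a : ℕ) := by
  rw [Finset.card_equiv σ (t := Finset.Iio a) (by simp), Fin.card_Iio]

theorem IsAllocationRule.orderStat_apply (hg : IsAllocationRule g) (c : Fin n → ℝ) (i : Fin n) :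
    orderStat c (g c i) = c i := by
  have hmono : Monotone ((fun i => -c i) ∘ (g c).symm) := by
    intro a b hab
    rcases hab.eq_or_lt with rfl | hlt
    · exact le_rfl
    · exact neg_le_neg (hg.sorted c _ _ (by simpa using hlt))
  have hsort := congrFun (Tuple.comp_sort_eq_comp_iff_monotone.2 hmono) (g c i)
  simpa [orderStat] using hsort.symm

theorem IsAllocationRule.lt_iff_lt (hg : IsAllocationRule g) {c : Fin n → ℝ}
    (hc : Function.Injective c) {i l : Fin n} : g c i < g c l ↔ c l < c i := by
  constructor
  · intro h
    exact (hg.sorted c i l h).lt_of_ne fun heq => h.ne (congrArg (g c) (hc heq).symm)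
  · intro h
    by_contra! hle
    have hne : g c l ≠ g c i := fun heq => h.ne (congrArg c ((g c).injective heq))
    exact h.not_ge (hg.sorted c l i (hle.lt_of_ne hne))

theorem sum_Ico_eq_sum_filter_perm (σ : Equiv.Perm (Fin n)) (i : Fin n) {k : ℕ} (hkn : k < n)
    {φ : ℕ → ℝ} (hφ : ∀ j, k ≤ j → φ j = 0) (H : ℕ → ℝ) :
    ∑ j ∈ Finset.Ico (σ i : ℕ) k, φ j * H (j + 1) =
      ∑ l with σ i < σ l, φ (σ l - 1) * H (σ l) := by
  have hmap : ∑ l with σ i < σ l, φ (σ l - 1) * H (σ l) =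
      ∑ j ∈ Finset.Ioo (σ i : ℕ) n, φ (j - 1) * H j := by
    rw [← Fin.map_valEmbedding_Ioi, Finset.sum_map]
    exact Finset.sum_equiv σ (by simp) (by simp)
  rw [hmap]
  refine Finset.sum_of_injOn (· + 1) (fun a _ b _ h => by simpa using h)
    (fun j hj => ?_) (fun j hj hj' => ?_) (fun j _ => by simp)
  · simp only [Finset.coe_Ico, Finset.coe_Ioo, mem_Ico, mem_Ioo] at hj ⊢
    omega
  · rw [hφ, zero_mul]
    by_contra! hlt
    simp only [Finset.mem_Ioo] at hj
    exact hj' ⟨j - 1, by simp only [Finset.coe_Ico, mem_Ico]; omega, by simp only; omega⟩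

/-- The sum of `h` over the entries of `w` on `S` below the threshold `t`, each weighted by `φ` of
the number of entries on `S` that exceed it. With `S` the rivals of an agent bidding `t`, it is the
form shared by VCG payments and assigned qualities. -/
def outbidSum {ι : Type*} (S : Finset ι) (φ : ℕ → ℝ) (h : ℝ → ℝ) (t : ℝ) (w : ι → ℝ) : ℝ :=
  ∑ l ∈ S with w l < t, φ #{m ∈ S | w l < w m} * h (w l)

theorem outbidSum_eq_sum_indicator {ι : Type*} (S : Finset ι) (φ : ℕ → ℝ) (h : ℝ → ℝ) (t : ℝ)
    (w : ι → ℝ) :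
    outbidSum S φ h t w =
      ∑ l ∈ S, φ #{m ∈ S | w l < w m} * (Iio t).indicator h (w l) := by
  rw [outbidSum, Finset.sum_filter]
  refine Finset.sum_congr rfl fun l _ => ?_
  by_cases hl : w l < t <;> simp [hl]

theorem IsAllocationRule.sum_Ico_eq_outbidSum (hg : IsAllocationRule g) {c : Fin n → ℝ}
    (hc : Function.Injective c) {k : ℕ} (hkn : k < n) {φ : ℕ → ℝ} (hφ : ∀ j, k ≤ j → φ j = 0)
    (h : ℝ → ℝ) (i : Fin n) :
    ∑ j ∈ Finset.Ico (g c i : ℕ) k, φ j * h (orderStat c (j + 1)) =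
      outbidSum (Finset.univ.erase i) φ h (c i) c := by
  rw [sum_Ico_eq_sum_filter_perm (g c) i hkn hφ fun j => h (orderStat c j), outbidSum]
  refine Finset.sum_congr ?_ fun l hl => ?_
  · ext l
    simp only [Finset.mem_filter, Finset.mem_univ, Finset.mem_erase, hg.lt_iff_lt hc, true_and,
      and_true]
    exact ⟨fun hlt => ⟨fun heq => hlt.ne (congrArg c heq), hlt⟩, And.right⟩
  · have hil : c l < c i := (Finset.mem_filter.1 hl).2
    have hcard : #{m ∈ Finset.univ.erase i | c l < c m} + 1 = (g c l : ℕ) := by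
      rw [Finset.filter_erase, Finset.card_erase_add_one (by simpa using hil),
        ← card_perm_lt (g c) (g c l)]
      simp only [hg.lt_iff_lt hc]
    rw [hg.orderStat_apply, ← hcard, Nat.add_sub_cancel]

theorem IsAllocationRule.vcgPayment_eq_outbidSum (hg : IsAllocationRule g) {c : Fin n → ℝ}
    (hc : Function.Injective c) {k : ℕ} (hkn : k < n) (α : Fin k → ℝ) (i : Fin n) :
    vcgPayment α g c i = outbidSum (Finset.univ.erase i) (decrement α) id (c i) c :=
  hg.sum_Ico_eq_outbidSum hc hkn (fun _ => decrement_of_le) id i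

theorem IsAllocationRule.ext_eq_outbidSum (hg : IsAllocationRule g) {c : Fin n → ℝ}
    (hc : Function.Injective c) {k : ℕ} (hkn : k < n) (β : Fin k → ℝ) (i : Fin n) :
    ext β (g c i) = outbidSum (Finset.univ.erase i) (decrement β) 1 (c i) c := by
  rw [← hg.sum_Ico_eq_outbidSum hc hkn fun _ => decrement_of_le, ← sum_Ico_decrement]
  simp

end Allocation

section ProductMeasure

variable {ι : Type*} [Fintype ι]

theorem measurePreserving_update [DecidableEq ι] {X : ι → Type*} [∀ i, MeasurableSpace (X i)]
    (μ : ∀ i, Measure (X i)) [∀ i, IsProbabilityMeasure (μ i)] (l : ι) :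
    MeasurePreserving (fun p : X l × (∀ i, X i) => Function.update p.2 l p.1)
      ((μ l).prod (Measure.pi μ)) (Measure.pi μ) := by
  have hmeas : Measurable fun p : X l × (∀ i, X i) => Function.update p.2 l p.1 :=
    measurable_update'.comp measurable_swap
  refine ⟨hmeas, (Measure.pi_eq fun s hs => ?_).symm⟩
  have hpre : (fun p : X l × (∀ i, X i) => Function.update p.2 l p.1) ⁻¹' univ.pi s =
      s l ×ˢ univ.pi (Function.update s l univ) := by
    ext p
    simp only [mem_preimage, mem_univ_pi, mem_prod]
    rw [Function.forall_update_iff p.2 fun i x => x ∈ s i,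
      Function.forall_update_iff s fun i t => p.2 i ∈ t]
    simp
  rw [Measure.map_apply hmeas (MeasurableSet.univ_pi hs), hpre, Measure.prod_prod, Measure.pi_pi,
    ← Finset.mul_prod_erase _ _ (Finset.mem_univ l),
    ← Finset.mul_prod_erase _ (fun i => μ i (s i)) (Finset.mem_univ l), Function.update_self,
    measure_univ, one_mul]
  congr 1
  refine Finset.prod_congr rfl fun i hi => ?_
  rw [Function.update_of_ne (Finset.ne_of_mem_erase hi)]

variable {X : Type*} [MeasurableSpace X] {μ : Measure X} [IsProbabilityMeasure μ]

theorem ae_ae_update [DecidableEq ι] {P : (ι → X) → Prop}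
    (hP : ∀ᵐ w ∂Measure.pi fun _ => μ, P w) (l : ι) :
    ∀ᵐ y ∂μ, ∀ᵐ w ∂Measure.pi fun _ => μ, P (Function.update w l y) :=
  Measure.ae_ae_of_ae_prod ((measurePreserving_update (fun _ => μ) l).quasiMeasurePreserving.ae hP)

theorem integral_pi_eq_integral_update [DecidableEq ι] {F : (ι → X) → ℝ}
    (hF : Integrable F (Measure.pi fun _ => μ)) (l : ι) :
    ∫ w, F w ∂(Measure.pi fun _ => μ) =
      ∫ y, ∫ w, F (Function.update w l y) ∂(Measure.pi fun _ => μ) ∂μ := by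
  have hmp := measurePreserving_update (fun _ : ι => μ) l
  have hFm : AEStronglyMeasurable F (Measure.map (fun p : X × (ι → X) =>
      Function.update p.2 l p.1) (μ.prod (Measure.pi fun _ => μ))) := by
    rw [hmp.map_eq]
    exact hF.aestronglyMeasurable
  have hint : Integrable (fun p : X × (ι → X) => F (Function.update p.2 l p.1))
      (μ.prod (Measure.pi fun _ => μ)) := hmp.integrable_comp_of_integrable hF
  rw [← integral_prod _ hint, ← integral_map hmp.measurable.aemeasurable hFm, hmp.map_eq]

theorem ae_pi_of_ae {p : ι → X → Prop} (h : ∀ i, ∀ᵐ x ∂μ, p i x) :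
    ∀ᵐ w ∂Measure.pi fun _ => μ, ∀ i, p i (w i) :=
  ae_all_iff.2 fun i => (Measure.quasiMeasurePreserving_eval (fun _ => μ) i).ae (h i)

theorem ae_pi_injective [MeasurableSingletonClass X] [MeasurableEq X] [NullSingletonClass μ] :
    ∀ᵐ w ∂Measure.pi fun _ : ι => μ, Function.Injective w := by
  classical
  have hne : ∀ i l : ι, i ≠ l → ∀ᵐ w ∂Measure.pi fun _ : ι => μ, w i ≠ w l := by
    intro i l hil
    have hmp := measurePreserving_update (fun _ : ι => μ) i
    have hm : MeasurableSet {w : ι → X | w i ≠ w l} :=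
      (measurableSet_eq_fun (measurable_pi_apply i) (measurable_pi_apply l)).compl
    rw [← hmp.map_eq, ae_map_iff hmp.measurable.aemeasurable hm]
    refine (Measure.ae_prod_iff_ae_ae (hmp.measurable hm)).2 (.of_forall fun y => ?_)
    filter_upwards [(Measure.quasiMeasurePreserving_eval (fun _ : ι => μ) l).ae (Measure.ae_ne μ y)]
      with w hw
    rw [Function.update_self, Function.update_of_ne hil.symm]
    exact hw.symm
  filter_upwards [ae_all_iff.2 fun i => ae_all_iff.2 fun l => ae_all_iff.2 (hne i l)] with w hw
  exact fun i l h => by_contra fun hil => hw i l hil h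

omit [Fintype ι] [MeasurableSpace X] in
theorem setOf_filter_eq_pi [DecidableEq ι] (P : X → Prop) [DecidablePred P]
    {S T : Finset ι} (hTS : T ⊆ S) :
    {w : ι → X | {m ∈ S | P (w m)} = T} =
      univ.pi fun m => if m ∈ T then {x | P x} else if m ∈ S then {x | P x}ᶜ else univ := by
  ext w
  simp only [mem_ofPred_eq, mem_univ_pi, Finset.ext_iff, Finset.mem_filter]
  refine forall_congr' fun m => ?_
  by_cases hmT : m ∈ T
  · simp [hmT, hTS hmT]
  · by_cases hmS : m ∈ S <;> simp [hmT, hmS]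

omit [Fintype ι] in
theorem measurableSet_filter_eq [Countable ι] {P : X → Prop} [DecidablePred P]
    (hP : MeasurableSet {x | P x}) {S T : Finset ι} (hTS : T ⊆ S) :
    MeasurableSet {w : ι → X | {m ∈ S | P (w m)} = T} := by
  classical
  rw [setOf_filter_eq_pi P hTS]
  refine MeasurableSet.univ_pi fun m => ?_
  split_ifs
  exacts [hP, hP.compl, MeasurableSet.univ]

theorem measureReal_filter_eq {P : X → Prop} [DecidablePred P] (hP : MeasurableSet {x | P x})
    {S T : Finset ι} (hTS : T ⊆ S) :
    (Measure.pi fun _ : ι => μ).real {w | {m ∈ S | P (w m)} = T} =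
      μ.real {x | P x} ^ #T * (1 - μ.real {x | P x}) ^ (#S - #T) := by
  classical
  have hfactor : ∀ m,
      μ.real (if m ∈ T then {x | P x} else if m ∈ S then {x | P x}ᶜ else univ) =
        (if m ∈ T then μ.real {x | P x} else 1) *
          (if m ∈ S \ T then 1 - μ.real {x | P x} else 1) := by
    intro m
    by_cases hmT : m ∈ T
    · simp [hmT]
    · by_cases hmS : m ∈ S <;> simp [hmT, hmS, probReal_compl_eq_one_sub hP]
  rw [setOf_filter_eq_pi P hTS, measureReal_def, Measure.pi_pi, ENNReal.toReal_prod]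
  simp only [← measureReal_def, hfactor]
  rw [Finset.prod_mul_distrib, Finset.prod_ite_mem, Finset.prod_ite_mem]
  simp [Finset.card_sdiff_of_subset hTS]

theorem integral_card_filter {P : X → Prop} [DecidablePred P] (hP : MeasurableSet {x | P x})
    (S : Finset ι) (φ : ℕ → ℝ) :
    ∫ w, φ #{m ∈ S | P (w m)} ∂(Measure.pi fun _ : ι => μ) =
      ∑ j ∈ Finset.range (#S + 1), φ j * (bernsteinPolynomial ℝ #S j).eval (μ.real {x | P x}) := by
  classical
  have hdecomp : ∀ w : ι → X, φ #{m ∈ S | P (w m)} = ∑ T ∈ S.powerset,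
      {w : ι → X | {m ∈ S | P (w m)} = T}.indicator (fun _ => φ #T) w := by
    intro w
    rw [Finset.sum_eq_single_of_mem {m ∈ S | P (w m)}
      (Finset.mem_powerset.2 (Finset.filter_subset _ _)) fun T _ hT => ?_]
    · simp
    · simp [hT.symm]
  simp only [hdecomp]
  rw [integral_finsetSum _ fun T hT => (integrable_const _).indicator
    (measurableSet_filter_eq hP (Finset.mem_powerset.1 hT))]
  have hterm : ∀ T ∈ S.powerset, ∫ w, {w : ι → X | {m ∈ S | P (w m)} = T}.indicator
      (fun _ => φ #T) w ∂(Measure.pi fun _ : ι => μ) =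
      φ #T * (μ.real {x | P x} ^ #T * (1 - μ.real {x | P x}) ^ (#S - #T)) := by
    intro T hT
    have hTS := Finset.mem_powerset.1 hT
    rw [integral_indicator_const _ (measurableSet_filter_eq hP hTS),
      measureReal_filter_eq hP hTS, smul_eq_mul, mul_comm]
  rw [Finset.sum_congr rfl hterm, Finset.sum_powerset_apply_card
    fun j => φ j * (μ.real {x | P x} ^ j * (1 - μ.real {x | P x}) ^ (#S - j))]
  refine Finset.sum_congr rfl fun j _ => ?_
  simp only [bernsteinPolynomial, nsmul_eq_mul, Polynomial.eval_mul, Polynomial.eval_pow,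
    Polynomial.eval_natCast, Polynomial.eval_X, Polynomial.eval_sub, Polynomial.eval_one]
  ring

end ProductMeasure

section OutbidSum

variable {ι : Type*} [Fintype ι] {μ : Measure ℝ} [IsProbabilityMeasure μ]

theorem measureReal_Ioi_eq_cdf (μ : Measure ℝ) [IsProbabilityMeasure μ] (y : ℝ) :
    μ.real (Ioi y) = 1 - cdf μ y := by
  rw [← compl_Iic, probReal_compl_eq_one_sub measurableSet_Iic, cdf_eq_real]

theorem measurable_card_filter_lt {ι : Type*} (S : Finset ι) (l : ι) :
    Measurable fun w : ι → ℝ => #{m ∈ S | w l < w m} := by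
  simp only [Finset.card_filter]
  exact Finset.measurable_sum _ fun m _ => Measurable.ite
    (measurableSet_lt (measurable_pi_apply l) (measurable_pi_apply m))
    measurable_const measurable_const

theorem integrable_outbid_term (S : Finset ι) (φ : ℕ → ℝ) (l : ι) {h : ℝ → ℝ}
    (hh : Integrable h μ) :
    Integrable (fun w => φ #{m ∈ S | w l < w m} * h (w l)) (Measure.pi fun _ : ι => μ) := by
  refine Integrable.bdd_mul (c := ∑ j ∈ Finset.range (#S + 1), ‖φ j‖)
    ((measurePreserving_eval (fun _ => μ) l).integrable_comp_of_integrable hh)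
    (measurable_from_top.comp (measurable_card_filter_lt S l)).aestronglyMeasurable
    (.of_forall fun w => ?_)
  exact Finset.single_le_sum (f := fun j => ‖φ j‖) (fun j _ => norm_nonneg _)
    (Finset.mem_range_succ_iff.2 (Finset.card_filter_le _ _))

/-- Conditioning on `w l`: the number of other entries above it is binomially distributed. -/
theorem integral_outbid_term {S : Finset ι} {l : ι} (hl : l ∈ S) (φ : ℕ → ℝ) {h : ℝ → ℝ}
    (hh : Integrable h μ) :
    ∫ w, φ #{m ∈ S | w l < w m} * h (w l) ∂(Measure.pi fun _ : ι => μ) =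
      ∫ y, h y * ∑ j ∈ Finset.range #S,
        φ j * (bernsteinPolynomial ℝ (#S - 1) j).eval (1 - cdf μ y) ∂μ := by
  classical
  have hrivals : ∀ (y : ℝ) (w : ι → ℝ),
      {m ∈ S | y < Function.update w l y m} = {m ∈ S.erase l | y < w m} := by
    intro y w
    ext m
    rcases eq_or_ne m l with rfl | hml
    · simp
    · simp [hml]
  rw [integral_pi_eq_integral_update (integrable_outbid_term S φ l hh) l]
  refine integral_congr_ae (.of_forall fun y => ?_)
  simp only [Function.update_self, hrivals]
  rw [integral_mul_const, integral_card_filter measurableSet_Ioi, Finset.card_erase_of_mem hl,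
    Nat.sub_add_cancel (Finset.card_pos.2 ⟨l, hl⟩), mul_comm, ← measureReal_Ioi_eq_cdf]
  rfl

theorem integrable_outbidSum (S : Finset ι) (φ : ℕ → ℝ) {h : ℝ → ℝ} {t : ℝ}
    (hh : IntegrableOn h (Iio t) μ) :
    Integrable (outbidSum S φ h t) (Measure.pi fun _ : ι => μ) := by
  simp only [funext (outbidSum_eq_sum_indicator S φ h t)]
  exact integrable_finsetSum _ fun l _ =>
    integrable_outbid_term S φ l (hh.integrable_indicator measurableSet_Iio)

theorem integral_outbidSum (S : Finset ι) (φ : ℕ → ℝ) {h : ℝ → ℝ} {t : ℝ}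
    (hh : IntegrableOn h (Iio t) μ) :
    ∫ w, outbidSum S φ h t w ∂(Measure.pi fun _ : ι => μ) =
      ∫ y in Iio t, h y * (#S * ∑ j ∈ Finset.range #S,
        φ j * (bernsteinPolynomial ℝ (#S - 1) j).eval (1 - cdf μ y)) ∂μ := by
  have hh' := hh.integrable_indicator measurableSet_Iio
  simp only [outbidSum_eq_sum_indicator]
  rw [integral_finsetSum _ fun l _ => integrable_outbid_term S φ l hh',
    Finset.sum_congr rfl fun l hl => integral_outbid_term hl φ hh', Finset.sum_const, nsmul_eq_mul,
    ← integral_const_mul, ← integral_indicator measurableSet_Iio]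
  refine integral_congr_ae (.of_forall fun y => ?_)
  by_cases hy : y ∈ Iio t
  · simp only [indicator_of_mem hy]
    ring
  · simp only [indicator_of_notMem hy, zero_mul, mul_zero]

end OutbidSum

section MarginalQuality

theorem integrableOn_mul_eval_cdf {μ : Measure ℝ} {s : Set ℝ} {h : ℝ → ℝ}
    (hh : IntegrableOn h s μ) (p : Polynomial ℝ) :
    IntegrableOn (fun y => h y * p.eval (1 - cdf μ y)) s μ := by
  obtain ⟨C, hC⟩ := isCompact_Icc.exists_bound_of_continuousOn (s := Icc 0 1) p.continuousOn
  refine Integrable.mul_bdd (c := C) hh ?_ (.of_forall fun y => hC _ ⟨?_, ?_⟩)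
  · exact (p.continuous.measurable.comp
      ((monotone_cdf μ).measurable.const_sub 1)).aestronglyMeasurable
  · exact sub_nonneg.2 (cdf_le_one μ y)
  · exact sub_le_self 1 (cdf_nonneg μ y)

theorem continuous_cdf (μ : Measure ℝ) [IsProbabilityMeasure μ] [NullSingletonClass μ] :
    Continuous (cdf μ) := by
  refine continuous_iff_continuousAt.2 fun x => ?_
  rw [(monotone_cdf μ).continuousAt_iff_leftLim_eq_rightLim, (cdf μ).rightLim_eq]
  have hx : (cdf μ).measure {x} = 0 := by rw [measure_cdf, measure_singleton]
  rw [StieltjesFunction.measure_singleton, ENNReal.ofReal_eq_zero] at hx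
  exact le_antisymm ((monotone_cdf μ).leftLim_le le_rfl) (sub_nonpos.1 hx)

theorem eval_bernsteinPolynomial_nonneg (m j : ℕ) {u : ℝ} (hu0 : 0 ≤ u) (hu1 : u ≤ 1) :
    0 ≤ (bernsteinPolynomial ℝ m j).eval u := by
  have : 0 ≤ 1 - u := sub_nonneg.2 hu1
  simp only [bernsteinPolynomial, Polynomial.eval_mul, Polynomial.eval_natCast,
    Polynomial.eval_pow, Polynomial.eval_X, Polynomial.eval_sub, Polynomial.eval_one]
  positivity

theorem eval_bernsteinPolynomial_pos {m j : ℕ} (hj : j ≤ m) {u : ℝ} (hu0 : 0 < u) (hu1 : u < 1) :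
    0 < (bernsteinPolynomial ℝ m j).eval u := by
  have : 0 < 1 - u := sub_pos.2 hu1
  have : 0 < m.choose j := Nat.choose_pos hj
  simp only [bernsteinPolynomial, Polynomial.eval_mul, Polynomial.eval_natCast,
    Polynomial.eval_pow, Polynomial.eval_X, Polynomial.eval_sub, Polynomial.eval_one]
  positivity

variable {n k : ℕ} {γ : Fin k → ℝ}

/-- The expected quality, under `γ`, of an agent each of whose `n - 1` rivals independently has a
higher bid with probability `X`. -/
def interimQuality (n : ℕ) (γ : Fin k → ℝ) : Polynomial ℝ :=
  ∑ s : Fin k, Polynomial.C (γ s) * bernsteinPolynomial ℝ (n - 1) s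

/-- The rate, per unit of probability of beating a given rival, at which the expected quality under
`γ` increases in an efficient allocation at the value `v`. -/
def marginalQuality (μ : Measure ℝ) (n : ℕ) (γ : Fin k → ℝ) (v : ℝ) : ℝ :=
  -(interimQuality n γ).derivative.eval (1 - cdf μ v)

theorem marginalQuality_eq_sum (μ : Measure ℝ) (γ : Fin k → ℝ) (v : ℝ) :
    marginalQuality μ n γ v = ∑ s : Fin k, γ s *
      -(bernsteinPolynomial ℝ (n - 1) s).derivative.eval (1 - cdf μ v) := by
  simp [marginalQuality, interimQuality, Polynomial.eval_finsetSum]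

/-- Summation by parts. -/
theorem marginalQuality_eq_sum_decrement (hkn : k < n) (μ : Measure ℝ) (γ : Fin k → ℝ) (v : ℝ) :
    marginalQuality μ n γ v = (n - 1 : ℕ) * ∑ j ∈ Finset.range (n - 1),
      decrement γ j * (bernsteinPolynomial ℝ (n - 1 - 1) j).eval (1 - cdf μ v) := by
  set B := fun j => (bernsteinPolynomial ℝ (n - 1 - 1) j).eval (1 - cdf μ v)
  set D := fun j => -(bernsteinPolynomial ℝ (n - 1) j).derivative.eval (1 - cdf μ v)
  have hD0 : D 0 = (n - 1 : ℕ) * B 0 := by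
    simp [D, B, bernsteinPolynomial.derivative_zero]
  have hD : ∀ j, D (j + 1) = (n - 1 : ℕ) * (B (j + 1) - B j) := by
    intro j
    simp only [D, B, bernsteinPolynomial.derivative_succ, Polynomial.eval_mul,
      Polynomial.eval_natCast, Polynomial.eval_sub]
    ring
  have hparts : ∀ m, ∑ j ∈ Finset.range (m + 1), ext γ j * D j =
      (n - 1 : ℕ) * (∑ j ∈ Finset.range m, decrement γ j * B j + ext γ m * B m) := by
    intro m
    induction m with
    | zero => rw [Finset.sum_range_one, hD0]; simp only [Finset.range_zero, Finset.sum_empty]; ring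
    | succ m ih => rw [Finset.sum_range_succ, ih, Finset.sum_range_succ, hD, decrement]; ring
  have hrange : ∑ s : Fin k, γ s * D s = ∑ j ∈ Finset.range (n - 1 + 1), ext γ j * D j := by
    rw [← Finset.sum_subset (Finset.range_subset_range.2 (by omega : k ≤ n - 1 + 1))
      fun j _ hj => by rw [ext_of_le (by simpa using hj), zero_mul], Finset.sum_range]
    simp [ext]
  rw [marginalQuality_eq_sum, hrange, hparts, ext_of_le (by omega : k ≤ n - 1), zero_mul, add_zero]

theorem integrableOn_mul_marginalQuality {μ : Measure ℝ} {s : Set ℝ} {h : ℝ → ℝ}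
    (hh : IntegrableOn h s μ) (n : ℕ) (γ : Fin k → ℝ) :
    IntegrableOn (fun y => h y * marginalQuality μ n γ y) s μ := by
  simpa [marginalQuality] using
    integrableOn_mul_eval_cdf hh (-(interimQuality n γ).derivative)

theorem integrable_marginalQuality (μ : Measure ℝ) [IsFiniteMeasure μ] (n : ℕ) (γ : Fin k → ℝ) :
    Integrable (marginalQuality μ n γ) μ := by
  simpa using integrableOn_mul_marginalQuality (s := univ) (integrable_const (1 : ℝ)) n γ

theorem continuous_marginalQuality (μ : Measure ℝ) [IsProbabilityMeasure μ] [NullSingletonClass μ]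
    (n : ℕ) (γ : Fin k → ℝ) : Continuous (marginalQuality μ n γ) :=
  ((Polynomial.continuous _).comp (continuous_const.sub (continuous_cdf μ))).neg

theorem marginalQuality_nonneg (hkn : k < n) (hγ : Antitone γ) (hγ0 : ∀ j, 0 < γ j)
    (μ : Measure ℝ) (v : ℝ) : 0 ≤ marginalQuality μ n γ v := by
  rw [marginalQuality_eq_sum_decrement hkn]
  refine mul_nonneg (Nat.cast_nonneg _) (Finset.sum_nonneg fun j _ =>
    mul_nonneg (decrement_nonneg hγ hγ0 j) (eval_bernsteinPolynomial_nonneg _ _ ?_ ?_))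
  · exact sub_nonneg.2 (cdf_le_one μ v)
  · exact sub_le_self 1 (cdf_nonneg μ v)

theorem marginalQuality_pos (hk : 0 < k) (hkn : k < n) (hγ : Antitone γ) (hγ0 : ∀ j, 0 < γ j)
    {μ : Measure ℝ} {v : ℝ} (hv : cdf μ v ∈ Ioo 0 1) : 0 < marginalQuality μ n γ v := by
  have hu0 : 0 < 1 - cdf μ v := sub_pos.2 hv.2
  have hu1 : 1 - cdf μ v < 1 := sub_lt_self 1 hv.1
  rw [marginalQuality_eq_sum_decrement hkn]
  refine mul_pos (Nat.cast_pos.2 (by omega)) (Finset.sum_pos' (fun j _ =>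
    mul_nonneg (decrement_nonneg hγ hγ0 j) (eval_bernsteinPolynomial_nonneg _ _ hu0.le hu1.le))
    ⟨k - 1, Finset.mem_range.2 (by omega), mul_pos ?_ (eval_bernsteinPolynomial_pos ?_ hu0 hu1)⟩)
  · rw [decrement, ext_of_le (j := k - 1 + 1) (by omega), sub_zero, ext_pos_iff hγ0]
    omega
  · omega

end MarginalQuality

section Density

variable {μ : Measure ℝ} {f : ℝ → ℝ}

theorem hasDerivAt_posProb {d v : ℝ} (h : HasDerivAt (cdf μ) d v) (n s : ℕ) :
    HasDerivAt (posProb μ n s)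
      (-(bernsteinPolynomial ℝ (n - 1) s).derivative.eval (1 - cdf μ v) * d) v := by
  have hcomp := ((bernsteinPolynomial ℝ (n - 1) s).hasDerivAt (1 - cdf μ v)).comp v (h.const_sub 1)
  refine (hcomp.congr_deriv (by ring)).congr_of_eventuallyEq (.of_forall fun y => ?_)
  simp [posProb, bernsteinPolynomial]

theorem ae_hasDerivAt_cdf [IsProbabilityMeasure μ] (hf : Measurable f) (hf0 : ∀ v, 0 ≤ f v)
    (hμf : μ = volume.withDensity fun v => ENNReal.ofReal (f v)) :
    ∀ᵐ v, HasDerivAt (cdf μ) (f v) v := by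
  have hfi : Integrable f := by
    refine ⟨hf.aestronglyMeasurable, ?_⟩
    rw [hasFiniteIntegral_iff_ofReal (.of_forall hf0), ← setLIntegral_univ,
      ← withDensity_apply _ MeasurableSet.univ, ← hμf]
    exact measure_lt_top μ univ
  have hcdf : ∀ v, cdf μ v = ∫ y in Iic v, f y := by
    intro v
    rw [cdf_eq_real, measureReal_def, hμf, withDensity_apply _ measurableSet_Iic,
      integral_eq_lintegral_of_nonneg_ae (.of_forall hf0) hf.aestronglyMeasurable]
  filter_upwards [LocallyIntegrable.ae_hasDerivAt_integral hfi.locallyIntegrable] with v hv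
  refine ((hv 0).add_const (cdf μ 0)).congr_of_eventuallyEq (.of_forall fun y => ?_)
  change cdf μ y = (∫ t in (0 : ℝ)..y, f t) + cdf μ 0
  rw [hcdf y, hcdf 0, ← intervalIntegral.integral_Iic_sub_Iic hfi.integrableOn hfi.integrableOn,
    sub_add_cancel]

theorem ae_deriv_posProb [IsProbabilityMeasure μ] (hf : Measurable f) (hf0 : ∀ v, 0 ≤ f v)
    (hμf : μ = volume.withDensity fun v => ENNReal.ofReal (f v)) (n : ℕ) :
    ∀ᵐ v, ∀ s, deriv (posProb μ n s) v =
      -(bernsteinPolynomial ℝ (n - 1) s).derivative.eval (1 - cdf μ v) * f v := by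
  filter_upwards [ae_hasDerivAt_cdf hf hf0 hμf] with v hv s
  exact (hasDerivAt_posProb hv n s).deriv

theorem measurable_candidateBid (μ : Measure ℝ) {k : ℕ} (n : ℕ) (α β : Fin k → ℝ) :
    Measurable (candidateBid μ n α β) := by
  refine Measurable.div (Finset.measurable_sum _ fun _ _ => ?_)
    (Finset.measurable_sum _ fun _ _ => measurable_const.mul (measurable_deriv _))
  exact (measurable_const.mul (measurable_deriv _)).mul measurable_id

/-- The bidding function `b^V` with the density cancelled, so that it is defined at every value. -/
def quantileBid {k : ℕ} (μ : Measure ℝ) (n : ℕ) (α β : Fin k → ℝ) (v : ℝ) : ℝ :=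
  v * marginalQuality μ n β v / marginalQuality μ n α v

theorem candidateBid_ae_eq_quantileBid [IsProbabilityMeasure μ] (hf : Measurable f)
    (hf0 : ∀ v, 0 ≤ f v) (hμf : μ = volume.withDensity fun v => ENNReal.ofReal (f v)) {k : ℕ}
    (n : ℕ) (α β : Fin k → ℝ) : candidateBid μ n α β =ᵐ[μ] quantileBid μ n α β := by
  have hvol : ∀ᵐ v, f v ≠ 0 → candidateBid μ n α β v = quantileBid μ n α β v := by
    filter_upwards [ae_deriv_posProb hf hf0 hμf n] with v hv hfv
    have hsum : ∀ γ : Fin k → ℝ,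
        ∑ s : Fin k, γ s * deriv (posProb μ n s) v = marginalQuality μ n γ v * f v := by
      intro γ
      simp only [marginalQuality_eq_sum, hv, Finset.sum_mul, mul_assoc]
    rw [candidateBid, ← Finset.sum_mul, hsum, hsum, quantileBid, mul_right_comm,
      mul_div_mul_right _ _ hfv, mul_comm v]
  have hdens : ∀ᵐ v ∂volume.withDensity fun v => ENNReal.ofReal (f v),
      candidateBid μ n α β v = quantileBid μ n α β v := by
    rw [ae_withDensity_iff hf.ennreal_ofReal]
    filter_upwards [hvol] with v hv hfv
    exact hv fun h => hfv (by rw [h, ENNReal.ofReal_zero])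
  rwa [← hμf] at hdens

theorem restrict_Iio_eq_withDensity_Ioc
    (hμf : μ = volume.withDensity fun v => ENNReal.ofReal (f v)) (hpos : ∀ᵐ y ∂μ, 0 < y) (v : ℝ) :
    μ.restrict (Iio v) =
      (volume.restrict (Ioc 0 v)).withDensity fun v => ENNReal.ofReal (f v) := by
  have : NullSingletonClass μ := hμf ▸ inferInstance
  have hset : Iio v =ᵐ[μ] Ioc 0 v := by
    filter_upwards [hpos, Measure.ae_ne μ v] with y hy hyv
    exact propext ⟨fun h => ⟨hy, (mem_Iio.1 h).le⟩, fun h => h.2.lt_of_ne hyv⟩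
  rw [Measure.restrict_congr_set hset, ← restrict_withDensity measurableSet_Ioc, ← hμf]

theorem integral_Iio_eq_intervalIntegral (hf : Measurable f) (hf0 : ∀ v, 0 ≤ f v)
    (hμf : μ = volume.withDensity fun v => ENNReal.ofReal (f v)) (hpos : ∀ᵐ y ∂μ, 0 < y)
    {v : ℝ} (hv : 0 ≤ v) (h : ℝ → ℝ) :
    ∫ y in Iio v, h y ∂μ = ∫ t in (0 : ℝ)..v, f t * h t := by
  rw [intervalIntegral.integral_of_le hv, restrict_Iio_eq_withDensity_Ioc hμf hpos,
    integral_withDensity_eq_integral_toReal_smul hf.ennreal_ofReal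
      (.of_forall fun _ => ENNReal.ofReal_lt_top)]
  simp only [ENNReal.toReal_ofReal (hf0 _), smul_eq_mul]

theorem intervalIntegrable_of_integrableOn_Iio (hf : Measurable f) (hf0 : ∀ v, 0 ≤ f v)
    (hμf : μ = volume.withDensity fun v => ENNReal.ofReal (f v)) (hpos : ∀ᵐ y ∂μ, 0 < y)
    {v : ℝ} (hv : 0 ≤ v) {h : ℝ → ℝ} (hh : IntegrableOn h (Iio v) μ) :
    IntervalIntegrable (fun t => f t * h t) volume 0 v := by
  rw [IntegrableOn, restrict_Iio_eq_withDensity_Ioc hμf hpos,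
    integrable_withDensity_iff_integrable_smul' hf.ennreal_ofReal
      (.of_forall fun _ => ENNReal.ofReal_lt_top)] at hh
  simpa only [intervalIntegrable_iff_integrableOn_Ioc_of_le hv, IntegrableOn,
    ENNReal.toReal_ofReal (hf0 _), smul_eq_mul] using hh

theorem integral_mul_marginalQuality_eq_sum [IsProbabilityMeasure μ] (hf : Measurable f)
    (hf0 : ∀ v, 0 ≤ f v) (hμf : μ = volume.withDensity fun v => ENNReal.ofReal (f v))
    (hpos : ∀ᵐ y ∂μ, 0 < y) {b : ℝ → ℝ} {v : ℝ} (hv : 0 ≤ v) (hb : IntegrableOn b (Iio v) μ)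
    {k : ℕ} (n : ℕ) (α : Fin k → ℝ) :
    (∀ s : Fin k, IntervalIntegrable (fun t => deriv (posProb μ n s) t * b t) volume 0 v) ∧
    ∫ y in Iio v, b y * marginalQuality μ n α y ∂μ =
      ∑ s : Fin k, α s * ∫ t in (0 : ℝ)..v, deriv (posProb μ n s) t * b t := by
  set D := fun (s : ℕ) y => b y * (-(bernsteinPolynomial ℝ (n - 1) s).derivative).eval (1 - cdf μ y)
  have hDi : ∀ s, IntegrableOn (D s) (Iio v) μ := fun s => integrableOn_mul_eval_cdf hb _
  have hD : ∀ s, ∀ᵐ t, f t * D s t = deriv (posProb μ n s) t * b t := by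
    intro s
    filter_upwards [ae_deriv_posProb hf hf0 hμf n] with t ht
    rw [ht s]
    simp only [D, Polynomial.eval_neg]
    ring
  constructor
  · intro s
    exact (intervalIntegrable_of_integrableOn_Iio hf hf0 hμf hpos hv (hDi s)).congr_ae
      (ae_restrict_of_ae (hD s))
  · have hsum : ∀ y, b y * marginalQuality μ n α y = ∑ s : Fin k, α s * D s y := by
      intro y
      simp only [marginalQuality_eq_sum, Finset.mul_sum, D, Polynomial.eval_neg]
      exact Finset.sum_congr rfl fun s _ => mul_left_comm _ _ _
    simp only [hsum]
    rw [integral_finsetSum _ fun (s : Fin k) _ => (hDi (s : ℕ)).const_mul (α s)]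
    refine Finset.sum_congr rfl fun s _ => ?_
    rw [integral_const_mul, integral_Iio_eq_intervalIntegral hf hf0 hμf hpos hv,
      intervalIntegral.integral_congr_ae ((hD s).mono fun t ht _ => ht)]

end Density

section Payoffs

variable {n k : ℕ} {μ : Measure ℝ} {α β : Fin k → ℝ} {g : (Fin n → ℝ) → Equiv.Perm (Fin n)}
  {A : Set ℝ} {b : ℝ → ℝ} {x t : ℝ}

theorem expectedUtility_congr [IsProbabilityMeasure μ] {B B' : Fin n → ℝ → ℝ}
    (hB : ∀ l, B l =ᵐ[μ] B' l) (i : Fin n) (x v : ℝ) :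
    expectedUtility μ α β g B i x v = expectedUtility μ α β g B' i x v := by
  refine integral_congr_ae ?_
  filter_upwards [ae_pi_of_ae hB] with w hw
  simp only [bids, hw]

theorem bids_self (B : Fin n → ℝ → ℝ) (i : Fin n) (x : ℝ) (w : Fin n → ℝ) : bids B i x w i = x := by
  rw [bids, Function.update_self]

theorem bids_of_ne (B : Fin n → ℝ → ℝ) {i l : Fin n} (hl : l ≠ i) (x : ℝ) (w : Fin n → ℝ) :
    bids B i x w l = B l (w l) := by
  rw [bids, Function.update_of_ne hl]

/-- The bid `x` separates the bids of the values in `A` in the same way as the value `t` separates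
the values themselves: bidding `x` amounts to bidding like the value `t`. -/
def IsThreshold (A : Set ℝ) (b : ℝ → ℝ) (x t : ℝ) : Prop :=
  ∀ y ∈ A, (y < t → b y < x) ∧ (t < y → x < b y)

theorem isThreshold_of_strictMonoOn (hb : StrictMonoOn b A) (ht : t ∈ A) :
    IsThreshold A b (b t) t :=
  fun _ hy => ⟨hb hy ht, hb ht hy⟩

theorem IsThreshold.mono {T : Set ℝ} (h : IsThreshold T b x t) (hAT : A ⊆ T) :
    IsThreshold A b x t :=
  fun y hy => h y (hAT hy)

theorem IsThreshold.lt_iff (h : IsThreshold A b x t) {y : ℝ} (hy : y ∈ A \ {t}) :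
    b y < x ↔ y < t := by
  refine ⟨fun hlt => ?_, (h y hy.1).1⟩
  by_contra! hle
  exact hlt.not_gt ((h y hy.1).2 (hle.lt_of_ne (Ne.symm hy.2)))

theorem IsThreshold.ne (h : IsThreshold A b x t) {y : ℝ} (hy : y ∈ A \ {t}) : b y ≠ x := by
  rcases lt_or_gt_of_ne (show y ≠ t from hy.2) with hlt | hlt
  exacts [((h y hy.1).1 hlt).ne, ((h y hy.1).2 hlt).ne']

theorem IsThreshold.integrableOn [IsFiniteMeasure μ] (h : IsThreshold A b x t)
    (hA : ∀ᵐ v ∂μ, v ∈ A) (hbm : Measurable b) (hb0 : ∀ v ∈ A, 0 ≤ b v) :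
    IntegrableOn b (Iio t) μ := by
  refine Integrable.of_bound hbm.aestronglyMeasurable x ?_
  filter_upwards [ae_restrict_of_ae hA, ae_restrict_mem measurableSet_Iio] with y hy hyt
  rw [Real.norm_of_nonneg (hb0 y hy)]
  exact ((h y hy).1 hyt).le

theorem IsThreshold.injective_bids (h : IsThreshold A b x t) (hb : StrictMonoOn b A) (i : Fin n)
    {w : Fin n → ℝ} (hw : ∀ l, w l ∈ A \ {t}) (hinj : Function.Injective w) :
    Function.Injective (bids (fun _ => b) i x w) := by
  intro l m hlm
  by_cases hl : l = i <;> by_cases hm : m = i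
  · rw [hl, hm]
  · rw [hl, bids_self, bids_of_ne _ hm] at hlm
    exact absurd hlm.symm (h.ne (hw m))
  · rw [hm, bids_self, bids_of_ne _ hl] at hlm
    exact absurd hlm (h.ne (hw l))
  · rw [bids_of_ne _ hl, bids_of_ne _ hm] at hlm
    exact hinj (hb.injOn (hw l).1 (hw m).1 hlm)

theorem IsThreshold.outbidSum_bids (h : IsThreshold A b x t) (hb : StrictMonoOn b A) (i : Fin n)
    {w : Fin n → ℝ} (hw : ∀ l, w l ∈ A \ {t}) (φ : ℕ → ℝ) (u : ℝ → ℝ) :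
    outbidSum (Finset.univ.erase i) φ u x (bids (fun _ => b) i x w) =
      outbidSum (Finset.univ.erase i) φ (u ∘ b) t w := by
  have hbid : ∀ l ∈ Finset.univ.erase i, bids (fun _ => b) i x w l = b (w l) :=
    fun l hl => bids_of_ne _ (Finset.ne_of_mem_erase hl) x w
  refine Finset.sum_congr (Finset.filter_congr fun l hl => ?_) fun l hl => ?_
  · rw [hbid l hl, h.lt_iff (hw l)]
  · have hl' := (Finset.mem_filter.1 hl).1
    have hrank : {m ∈ Finset.univ.erase i |
        bids (fun _ => b) i x w l < bids (fun _ => b) i x w m} =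
        {m ∈ Finset.univ.erase i | w l < w m} := by
      refine Finset.filter_congr fun m hm => ?_
      rw [hbid l hl', hbid m hm, hb.lt_iff_lt (hw l).1 (hw m).1]
    rw [hrank, hbid l hl', Function.comp_apply]

variable [IsProbabilityMeasure μ]

theorem integral_outbidSum_decrement (hkn : k < n) (γ : Fin k → ℝ) (i : Fin n) {h : ℝ → ℝ}
    (hh : IntegrableOn h (Iio t) μ) :
    ∫ w, outbidSum (Finset.univ.erase i) (decrement γ) h t w ∂(Measure.pi fun _ : Fin n => μ) =
      ∫ y in Iio t, h y * marginalQuality μ n γ y ∂μ := by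
  simp only [marginalQuality_eq_sum_decrement hkn]
  rw [integral_outbidSum _ _ hh, Finset.card_erase_of_mem (Finset.mem_univ i), Finset.card_fin]

variable [NullSingletonClass μ]

theorem IsThreshold.ae_outcome (h : IsThreshold A b x t) (hkn : k < n) (hg : IsAllocationRule g)
    (hA : ∀ᵐ v ∂μ, v ∈ A) (hb : StrictMonoOn b A) (α β : Fin k → ℝ) (i : Fin n) :
    ∀ᵐ w ∂Measure.pi fun _ : Fin n => μ,
      vcgPayment α g (bids (fun _ => b) i x w) i =
        outbidSum (Finset.univ.erase i) (decrement α) b t w ∧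
      ext β (g (bids (fun _ => b) i x w) i) =
        outbidSum (Finset.univ.erase i) (decrement β) 1 t w := by
  have hAt : ∀ᵐ v ∂μ, v ∈ A \ {t} := by
    filter_upwards [hA, Measure.ae_ne μ t] with v hv hvt using ⟨hv, hvt⟩
  filter_upwards [ae_pi_of_ae fun _ : Fin n => hAt, ae_pi_injective] with w hw hinj
  have hc := h.injective_bids hb i hw hinj
  rw [hg.vcgPayment_eq_outbidSum hc hkn, hg.ext_eq_outbidSum hc hkn, bids_self,
    h.outbidSum_bids hb i hw, h.outbidSum_bids hb i hw]
  exact ⟨rfl, rfl⟩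

theorem IsThreshold.expectedPayment_eq (h : IsThreshold A b x t) (hkn : k < n)
    (hg : IsAllocationRule g) (hA : ∀ᵐ v ∂μ, v ∈ A) (hbm : Measurable b) (hb : StrictMonoOn b A)
    (hb0 : ∀ v ∈ A, 0 ≤ b v) (i : Fin n) :
    expectedPayment μ α g (fun _ => b) i x = ∫ y in Iio t, b y * marginalQuality μ n α y ∂μ := by
  rw [← integral_outbidSum_decrement hkn α i (h.integrableOn hA hbm hb0)]
  exact integral_congr_ae ((h.ae_outcome hkn hg hA hb α α i).mono fun w hw => hw.1)

theorem IsThreshold.expectedUtility_eq (h : IsThreshold A b x t) (hkn : k < n)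
    (hg : IsAllocationRule g) (hA : ∀ᵐ v ∂μ, v ∈ A) (hbm : Measurable b) (hb : StrictMonoOn b A)
    (hb0 : ∀ v ∈ A, 0 ≤ b v) (i : Fin n) (v : ℝ) :
    expectedUtility μ α β g (fun _ => b) i x v =
      v * ∫ y in Iio t, marginalQuality μ n β y ∂μ -
        ∫ y in Iio t, b y * marginalQuality μ n α y ∂μ := by
  have hbi := h.integrableOn hA hbm hb0
  have h1i : IntegrableOn (1 : ℝ → ℝ) (Iio t) μ := integrable_const _
  have hβ := integral_outbidSum_decrement hkn β i h1i
  simp only [Pi.one_apply, one_mul] at hβ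
  rw [← integral_outbidSum_decrement hkn α i hbi, ← hβ, ← integral_const_mul,
    ← integral_sub ((integrable_outbidSum _ _ h1i).const_mul v) (integrable_outbidSum _ _ hbi)]
  refine integral_congr_ae ((h.ae_outcome hkn hg hA hb α β i).mono fun w hw => ?_)
  simp only [utility, hw.1, hw.2, mul_comm v]

theorem ae_expectedPayment_eq {f : ℝ → ℝ} (hf : Measurable f) (hf0 : ∀ v, 0 ≤ f v)
    (hμf : μ = volume.withDensity fun v => ENNReal.ofReal (f v)) (hpos : ∀ᵐ v ∂μ, 0 < v)
    (hkn : k < n) (hg : IsAllocationRule g) (hbm : Measurable b) (hb0 : ∀ᵐ v ∂μ, 0 ≤ b v)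
    (hb : IncreasingAE μ b) (i : Fin n) :
    ∀ᵐ v ∂μ,
      (∀ s : Fin k, IntervalIntegrable (fun t => deriv (posProb μ n s) t * b t) volume 0 v) ∧
      expectedPayment μ α g (fun _ => b) i (b v) =
        ∑ s : Fin k, α s * ∫ t in (0 : ℝ)..v, deriv (posProb μ n s) t * b t := by
  obtain ⟨N, hN, hmono⟩ := hb
  have hA : ∀ᵐ v ∂μ, v ∈ Nᶜ ∩ {v | 0 ≤ b v} := by
    filter_upwards [measure_eq_zero_iff_ae_notMem.1 hN, hb0] with v hvN hv using ⟨hvN, hv⟩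
  have hbA : StrictMonoOn b (Nᶜ ∩ {v | 0 ≤ b v}) := hmono.mono inter_subset_left
  filter_upwards [hA, hpos] with v hv hv0
  have ht := isThreshold_of_strictMonoOn hbA hv
  obtain ⟨hint, heq⟩ := integral_mul_marginalQuality_eq_sum hf hf0 hμf hpos hv0.le
    (ht.integrableOn hA hbm fun _ h => h.2) n α
  exact ⟨hint, (ht.expectedPayment_eq hkn hg hA hbm hbA (fun _ h => h.2) i).trans heq⟩

end Payoffs

section Support

variable {μ : Measure ℝ} {vbar : ℝ}

theorem ae_mem_Ioo [NullSingletonClass μ] (hsupp : μ.support = Icc 0 vbar) :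
    ∀ᵐ v ∂μ, v ∈ Ioo 0 vbar := by
  have hmem : ∀ᵐ v ∂μ, v ∈ Icc 0 vbar := hsupp ▸ Measure.support_mem_ae
  filter_upwards [hmem, Measure.ae_ne μ 0, Measure.ae_ne μ vbar] with v hv h0 h1
  exact ⟨hv.1.lt_of_ne h0.symm, hv.2.lt_of_ne h1⟩

theorem measure_Ioo_pos (hsupp : μ.support = Icc 0 vbar) {a c : ℝ} (ha : 0 ≤ a) (hac : a < c)
    (hc : c ≤ vbar) : 0 < μ (Ioo a c) := by
  obtain ⟨z, hz⟩ := nonempty_Ioo.2 hac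
  have hz' : z ∈ μ.support := hsupp ▸ ⟨ha.trans hz.1.le, hz.2.le.trans hc⟩
  exact (Measure.mem_support_iff_forall z).1 hz' _ (Ioo_mem_nhds hz.1 hz.2)

theorem exists_mem_Ioo_of_ae (hsupp : μ.support = Icc 0 vbar) {P : ℝ → Prop}
    (hP : ∀ᵐ v ∂μ, P v) {a c : ℝ} (ha : 0 ≤ a) (hac : a < c) (hc : c ≤ vbar) :
    ∃ z ∈ Ioo a c, P z :=
  ((frequently_ae_mem_iff.2 (measure_Ioo_pos hsupp ha hac hc).ne').and_eventually hP).exists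

theorem cdf_mem_Ioo [IsProbabilityMeasure μ] (hsupp : μ.support = Icc 0 vbar) {v : ℝ}
    (hv : v ∈ Ioo 0 vbar) : cdf μ v ∈ Ioo 0 1 := by
  constructor
  · rw [cdf_eq_real]
    exact ENNReal.toReal_pos ((measure_Ioo_pos hsupp le_rfl hv.1 hv.2.le).trans_le
      (measure_mono fun y hy => hy.2.le)).ne' (measure_ne_top μ _)
  · rw [← sub_pos, ← measureReal_Ioi_eq_cdf]
    exact ENNReal.toReal_pos ((measure_Ioo_pos hsupp hv.1.le hv.2 le_rfl).trans_le
      (measure_mono fun y hy => hy.1)).ne' (measure_ne_top μ _)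

theorem Icc_subset_closure_of_ae (hsupp : μ.support = Icc 0 vbar) {A : Set ℝ}
    (hA : ∀ᵐ v ∂μ, v ∈ A) {a c : ℝ} (ha : 0 ≤ a) (hac : a < c) (hc : c ≤ vbar) :
    Icc a c ⊆ closure (Ioo a c ∩ A) := by
  rw [← closure_Ioo hac.ne]
  refine closure_minimal (fun z hz => mem_closure_iff.2 fun o ho hzo => ?_) isClosed_closure
  have hz' : z ∈ μ.support := hsupp ▸ ⟨ha.trans hz.1.le, hz.2.le.trans hc⟩
  have hpos : 0 < μ (o ∩ Ioo a c) := (Measure.mem_support_iff_forall z).1 hz' _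
    ((ho.inter isOpen_Ioo).mem_nhds ⟨hzo, hz⟩)
  obtain ⟨y, hy, hyA⟩ := ((frequently_ae_mem_iff.2 hpos.ne').and_eventually hA).exists
  exact ⟨y, hy.1, hy.2, hyA⟩

theorem bddAbove_image_Ioo_of_ae_le (hsupp : μ.support = Icc 0 vbar) {q : ℝ → ℝ}
    (hq : MonotoneOn q (Ioo 0 vbar)) {C : ℝ} (hC : ∀ᵐ v ∂μ, q v ≤ C) :
    BddAbove (q '' Ioo 0 vbar) := by
  refine ⟨C, forall_mem_image.2 fun v hv => ?_⟩
  obtain ⟨z, hz, hzC⟩ := exists_mem_Ioo_of_ae hsupp hC hv.1.le hv.2 le_rfl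
  exact (hq hv ⟨hv.1.trans hz.1, hz.2⟩ hz.1.le).trans hzC

theorem IncreasingAE.congr {b c : ℝ → ℝ} (hb : IncreasingAE μ b) (hbc : b =ᵐ[μ] c) :
    IncreasingAE μ c := by
  obtain ⟨N, hN, hmono⟩ := hb
  refine ⟨N ∪ {v | b v ≠ c v}, measure_union_null hN (ae_iff.1 hbc), ?_⟩
  rw [compl_union]
  exact (hmono.mono inter_subset_left).congr fun v hv => not_not.1 hv.2

theorem IncreasingAE.strictMonoOn_Ioo (hsupp : μ.support = Icc 0 vbar) {c : ℝ → ℝ}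
    (hinc : IncreasingAE μ c) (hc : ContinuousOn c (Ioo 0 vbar)) :
    StrictMonoOn c (Ioo 0 vbar) := by
  obtain ⟨N, hN, hmono⟩ := hinc
  have hA : ∀ᵐ v ∂μ, v ∈ Nᶜ := measure_eq_zero_iff_ae_notMem.1 hN
  have hcont : ∀ x ∈ Ioo 0 vbar, ContinuousAt c x := fun x hx =>
    hc.continuousAt (isOpen_Ioo.mem_nhds hx)
  intro x hx y hy hxy
  obtain ⟨z, ⟨hxz, hzy⟩, hz⟩ := exists_mem_Ioo_of_ae hsupp hA hx.1.le hxy hy.2.le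
  obtain ⟨z', ⟨hzz', hz'y⟩, hz'⟩ := exists_mem_Ioo_of_ae hsupp hA (hx.1.trans hxz).le hzy hy.2.le
  have hleft : c x ≤ c z := ContinuousWithinAt.closure_le
    (Icc_subset_closure_of_ae hsupp hA hx.1.le hxz (hzy.trans hy.2).le (left_mem_Icc.2 hxz.le))
    (hcont x hx).continuousWithinAt continuousWithinAt_const
    fun u hu => (hmono hu.2 hz hu.1.2).le
  have hright : c z' ≤ c y := ContinuousWithinAt.closure_le
    (Icc_subset_closure_of_ae hsupp hA ((hx.1.trans hxz).trans hzz').le hz'y hy.2.le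
      (right_mem_Icc.2 hz'y.le))
    continuousWithinAt_const (hcont y hy).continuousWithinAt
    fun u hu => (hmono hz' hu.2 hu.1.1).le
  exact hleft.trans_lt ((hmono hz hz' hzz').trans_le hright)

theorem exists_of_ae_pi {ι X : Type*} [Fintype ι] [MeasurableSpace X] {μ : Measure X}
    [SigmaFinite μ] {P : (ι → X) → Prop} (hP : ∀ᵐ w ∂Measure.pi fun _ => μ, P w)
    {S : ι → Set X} (hS : ∀ l, 0 < μ (S l)) : ∃ w, (∀ l, w l ∈ S l) ∧ P w := by
  have hpos : Measure.pi (fun _ => μ) (univ.pi S) ≠ 0 := by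
    rw [Measure.pi_pi]
    exact Finset.prod_ne_zero_iff.2 fun l _ => (hS l).ne'
  obtain ⟨w, hw, hPw⟩ := ((frequently_ae_mem_iff.2 hpos).and_eventually hP).exists
  exact ⟨w, fun l => hw l (mem_univ l), hPw⟩

end Support

section Efficiency

variable {n k : ℕ} {β : Fin k → ℝ}

theorem IsEfficient.ext_le_ext {v : Fin n → ℝ} {σ : Equiv.Perm (Fin n)} (h : IsEfficient β v σ)
    {i l : Fin n} (hil : v i < v l) : ext β (σ i) ≤ ext β (σ l) := by
  have hne : i ≠ l := fun heq => hil.ne (congrArg v heq)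
  have hgain : ∑ m, (ext β ((σ * Equiv.swap i l) m) * v m - ext β (σ m) * v m) =
      (ext β (σ i) - ext β (σ l)) * (v l - v i) := by
    rw [Finset.sum_eq_add i l hne]
    · simp only [Equiv.Perm.mul_apply, Equiv.swap_apply_left, Equiv.swap_apply_right]
      ring
    · rintro m - ⟨hi, hl⟩
      rw [Equiv.Perm.mul_apply, Equiv.swap_apply_of_ne_of_ne hi hl, sub_self]
    · simp
    · simp
  have hle := sub_nonpos.2 (h (σ * Equiv.swap i l))
  rw [← Finset.sum_sub_distrib, hgain] at hle
  exact sub_nonpos.1 (nonpos_of_mul_nonpos_left hle (sub_pos.2 hil))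

theorem card_perm_val_lt (hkn : k ≤ n) (σ : Equiv.Perm (Fin n)) : #{m | (σ m : ℕ) < k} = k := by
  rw [Finset.card_equiv σ (t := {a : Fin n | (a : ℕ) < k}) (by simp), Fin.card_filter_val_lt,
    min_eq_right hkn]

theorem IsEfficient.val_lt_iff (hkn : k ≤ n) (hβ0 : ∀ j, 0 < β j) {v : Fin n → ℝ}
    {σ : Equiv.Perm (Fin n)} (h : IsEfficient β v σ) {p : ℝ} (hp : #{m | p < v m} = k)
    (m : Fin n) : (σ m : ℕ) < k ↔ p < v m := by
  suffices hset : ({m | p < v m} : Finset (Fin n)) = ({m | (σ m : ℕ) < k} : Finset (Fin n)) by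
    simpa using (Finset.ext_iff.1 hset m).symm
  refine Finset.eq_of_subset_of_card_le (fun m hm => ?_) (by rw [hp, card_perm_val_lt hkn])
  by_contra hmk
  simp only [Finset.mem_filter, Finset.mem_univ, true_and] at hm hmk
  have hsub : ({a | (σ a : ℕ) < k} : Finset (Fin n)) ⊂ ({a | p < v a} : Finset (Fin n)) := by
    refine (Finset.ssubset_iff_of_subset fun a ha => ?_).2
      ⟨m, by simpa using hm, by simpa using hmk⟩
    simp only [Finset.mem_filter, Finset.mem_univ, true_and] at ha ⊢
    by_contra! hle
    exact hmk ((ext_pos_iff hβ0).1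
      (((ext_pos_iff hβ0).2 ha).trans_le (h.ext_le_ext (hle.trans_lt hm))))
  exact (Finset.card_lt_card hsub).ne ((card_perm_val_lt hkn σ).trans hp.symm)

variable {μ : Measure ℝ} [IsProbabilityMeasure μ] {vbar : ℝ}
  {g : (Fin n → ℝ) → Equiv.Perm (Fin n)} {b : Fin n → ℝ → ℝ}

theorem exists_card_eq_pred {i l : Fin n} (hil : i ≠ l) (hkn : k < n) :
    ∃ H : Finset (Fin n), i ∉ H ∧ l ∉ H ∧ #H = k - 1 := by
  obtain ⟨H, hsub, hcard⟩ := Finset.exists_subset_card_eq (s := {i, l}ᶜ) (n := k - 1) (by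
    rw [Finset.card_compl, Finset.card_pair hil, Fintype.card_fin]
    omega)
  exact ⟨H, fun h => by simpa using hsub h, fun h => by simpa using hsub h, hcard⟩

-- `k - 1` further agents above `y` make the values `x` and `y` pivotal for the last position.
theorem bid_le_bid_of_ae_isEfficient_update (hk : 0 < k) (hkn : k < n) (hβ0 : ∀ j, 0 < β j)
    (hsupp : μ.support = Icc 0 vbar) (hg : IsAllocationRule g) {i l : Fin n} (hil : i ≠ l)
    {x y : ℝ} (hx : 0 < x) (hxy : x < y) (hy : y < vbar)
    (heff : ∀ᵐ w ∂Measure.pi fun _ : Fin n => μ,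
      IsEfficient β (Function.update (Function.update w l y) i x)
        (g fun m => b m (Function.update (Function.update w l y) i x m))) :
    b i x ≤ b l y := by
  obtain ⟨H, hiH, hlH, hcard⟩ := exists_card_eq_pred hil hkn
  obtain ⟨w, hw, hwe⟩ := exists_of_ae_pi heff
    (S := fun m => if m ∈ H then Ioo y vbar else Ioo 0 x) fun m => by
      split_ifs
      · exact measure_Ioo_pos hsupp (hx.trans hxy).le hy le_rfl
      · exact measure_Ioo_pos hsupp le_rfl hx (hxy.trans hy).le
  set v := Function.update (Function.update w l y) i x
  have hvi : v i = x := Function.update_self ..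
  have hvl : v l = y := by simp [v, hil.symm]
  have hv : ∀ m, x < v m ↔ m ∈ insert l H := by
    intro m
    rcases eq_or_ne m i with rfl | hmi
    · simp [hvi, hil, hiH]
    rcases eq_or_ne m l with rfl | hml
    · simp [hvl, hxy]
    have hvm : v m = w m := by simp [v, hmi, hml]
    have hwm := hw m
    by_cases hmH : m ∈ H
    · simp only [hmH, if_true] at hwm
      simp [hvm, hmH, hxy.trans hwm.1]
    · simp only [hmH, if_false] at hwm
      simp [hvm, hml, hmH, hwm.2.le]
  have hp : #{m | x < v m} = k := by
    simp only [hv, Finset.filter_univ_mem, Finset.card_insert_of_notMem hlH, hcard]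
    omega
  have hi := (hwe.val_lt_iff hkn.le hβ0 hp i).not.2 (by simp [hvi])
  have hl := (hwe.val_lt_iff hkn.le hβ0 hp l).2 (by rwa [hvl])
  simpa [hvi, hvl] using hg.sorted _ l i (Fin.lt_def.2 (hl.trans_le (not_lt.1 hi)))

theorem ae_ae_bid_le_bid [NullSingletonClass μ] (hk : 0 < k) (hkn : k < n) (hβ0 : ∀ j, 0 < β j)
    (hsupp : μ.support = Icc 0 vbar) (hg : IsAllocationRule g)
    (heff : ∀ᵐ v ∂Measure.pi fun _ : Fin n => μ, IsEfficient β v (g fun i => b i (v i)))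
    {i l : Fin n} (hil : i ≠ l) :
    ∀ᵐ x ∂μ, ∀ᵐ y ∂μ, (x < y → b i x ≤ b l y) ∧ (y < x → b l y ≤ b i x) := by
  filter_upwards [ae_mem_Ioo hsupp, ae_ae_update heff i] with x hx hxe
  filter_upwards [ae_mem_Ioo hsupp, ae_ae_update hxe l] with y hy hye
  refine ⟨fun hxy => ?_, fun hyx => ?_⟩
  · exact bid_le_bid_of_ae_isEfficient_update hk hkn hβ0 hsupp hg hil hx.1 hxy hy.2 hye
  · refine bid_le_bid_of_ae_isEfficient_update hk hkn hβ0 hsupp hg hil.symm hy.1 hyx hx.2 ?_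
    simpa only [Function.update_comm hil.symm] using hye

theorem exists_conull_bid_le_bid [NullSingletonClass μ] (hk : 0 < k) (hkn : k < n)
    (hβ0 : ∀ j, 0 < β j) (hsupp : μ.support = Icc 0 vbar) (hg : IsAllocationRule g)
    (heff : ∀ᵐ v ∂Measure.pi fun _ : Fin n => μ, IsEfficient β v (g fun i => b i (v i))) :
    ∃ A : Set ℝ, (∀ᵐ v ∂μ, v ∈ A) ∧ A ⊆ Ioo 0 vbar ∧
      ∀ i l, ∀ x ∈ A, ∀ y ∈ A, x < y → b i x ≤ b l y := by
  set A : Set ℝ := {x | x ∈ Ioo 0 vbar ∧ ∀ i l, i ≠ l →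
    ∀ᵐ y ∂μ, (x < y → b i x ≤ b l y) ∧ (y < x → b l y ≤ b i x)}
  have hA : ∀ᵐ x ∂μ, x ∈ A := by
    refine (ae_mem_Ioo hsupp).and (ae_all_iff.2 fun i => ae_all_iff.2 fun l => ?_)
    exact Filter.eventually_imp_distrib_left.2 (ae_ae_bid_le_bid hk hkn hβ0 hsupp hg heff)
  have hmono : ∀ i, ∀ x ∈ A, ∀ y ∈ A, x < y → b i x ≤ b i y := by
    intro i x hx y hy hxy
    have : Nontrivial (Fin n) := Fin.nontrivial_iff_two_le.2 (by omega)
    obtain ⟨l, hl⟩ := exists_ne i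
    obtain ⟨z, hz, hxz, hzy⟩ := exists_mem_Ioo_of_ae hsupp
      ((hx.2 i l hl.symm).and (hy.2 i l hl.symm)) hx.1.1.le hxy hy.1.2.le
    exact (hxz.1 hz.1).trans (hzy.2 hz.2)
  refine ⟨A, hA, fun x hx => hx.1, fun i l x hx y hy hxy => ?_⟩
  rcases eq_or_ne i l with rfl | hil
  · exact hmono i x hx y hy hxy
  · obtain ⟨z, hz, hzA, hxz⟩ :=
      exists_mem_Ioo_of_ae hsupp (hA.and (hx.2 i l hil)) hx.1.1.le hxy hy.1.2.le
    exact (hxz.1 hz.1).trans (hmono l z hzA y hy hz.2)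

theorem exists_bid_ne (hk : 0 < k) (hkn : k < n) (hβ0 : ∀ j, 0 < β j)
    (hsupp : μ.support = Icc 0 vbar)
    (heff : ∀ᵐ v ∂Measure.pi fun _ : Fin n => μ, IsEfficient β v (g fun i => b i (v i)))
    {A : Set ℝ} (hA : ∀ᵐ v ∂μ, v ∈ A) {x y : ℝ} (hx : 0 ≤ x) (hxy : x < y) (hy : y ≤ vbar)
    (c : ℝ) : ∃ l, ∃ z ∈ A ∩ Ioo x y, b l z ≠ c := by
  by_contra! hconst
  set σ := g fun _ => c
  set first := σ.symm ⟨0, by omega⟩ with hfirst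
  set last := σ.symm ⟨n - 1, by omega⟩ with hlast
  have hne : last ≠ first := by
    rw [hfirst, hlast, Ne, σ.symm.injective.eq_iff, Fin.mk.injEq]
    omega
  obtain ⟨z, hxz, hzy⟩ := exists_between hxy
  obtain ⟨w, hw, hwA, hwe⟩ := exists_of_ae_pi ((ae_pi_of_ae fun _ : Fin n => hA).and heff)
    (S := fun m => if m = first then Ioo x z else Ioo z y) fun m => by
      split_ifs
      · exact measure_Ioo_pos hsupp hx hxz (hzy.le.trans hy)
      · exact measure_Ioo_pos hsupp (hx.trans hxz.le) hzy hy
  have hbid : (fun m => b m (w m)) = fun _ => c := by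
    ext m
    refine hconst m (w m) ⟨hwA m, ?_⟩
    have hwm := hw m
    split_ifs at hwm
    exacts [⟨hwm.1, hwm.2.trans hzy⟩, ⟨hxz.trans hwm.1, hwm.2⟩]
  rw [hbid] at hwe
  have hlt : w first < w last := by
    have h0 := hw first
    have h1 := hw last
    simp only [if_true, if_neg hne] at h0 h1
    exact h0.2.trans h1.1
  have hpos : 0 < ext β (σ first) := (ext_pos_iff hβ0).2 (by simpa [first] using hk)
  have hlastk : (σ last : ℕ) < k := (ext_pos_iff hβ0).1 (hpos.trans_le (hwe.ext_le_ext hlt))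
  simp only [last, Equiv.apply_symm_apply] at hlastk
  omega

theorem strictMonoOn_of_bid_le_bid (hk : 0 < k) (hkn : k < n) (hβ0 : ∀ j, 0 < β j)
    (hsupp : μ.support = Icc 0 vbar)
    (heff : ∀ᵐ v ∂Measure.pi fun _ : Fin n => μ, IsEfficient β v (g fun i => b i (v i)))
    {A : Set ℝ} (hA : ∀ᵐ v ∂μ, v ∈ A) (hAI : A ⊆ Ioo 0 vbar)
    (hle : ∀ i l, ∀ x ∈ A, ∀ y ∈ A, x < y → b i x ≤ b l y) (i : Fin n) :
    StrictMonoOn (b i) A := by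
  intro x hx y hy hxy
  obtain ⟨l, z, ⟨hzA, hz⟩, hne⟩ :=
    exists_bid_ne hk hkn hβ0 hsupp heff hA (hAI hx).1.le hxy (hAI hy).2.le (b i x)
  exact ((hle i l x hx z hzA hz.1).lt_of_ne hne.symm).trans_le (hle l i z hzA y hy hz.2)

theorem countable_setOf_lt_of_interlaced {ι : Type*} [LinearOrder ι] {A : Set ι} {p q : ι → ℝ}
    (h : ∀ x ∈ A, ∀ y ∈ A, x < y → q x ≤ p y) : {x ∈ A | p x < q x}.Countable := by
  refine PairwiseDisjoint.countable_of_isOpen (s := fun x => Ioo (p x) (q x)) ?_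
    (fun _ _ => isOpen_Ioo) fun x hx => nonempty_Ioo.2 hx.2
  intro x hx y hy hxy
  refine Set.disjoint_left.2 fun z hzx hzy => ?_
  rcases hxy.lt_or_gt with hlt | hlt
  · exact (hzx.2.trans_le (h x hx.1 y hy.1 hlt)).not_gt hzy.1
  · exact (hzy.2.trans_le (h y hy.1 x hx.1 hlt)).not_gt hzx.1

theorem ae_eq_of_bid_le_bid {μ : Measure ℝ} [NullSingletonClass μ] {A : Set ℝ}
    (hA : ∀ᵐ v ∂μ, v ∈ A) (hle : ∀ i l, ∀ x ∈ A, ∀ y ∈ A, x < y → b i x ≤ b l y)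
    (i l : Fin n) : b i =ᵐ[μ] b l := by
  have hnull : ∀ i l, ∀ᵐ v ∂μ, v ∉ {x ∈ A | b i x < b l x} := fun i l =>
    measure_eq_zero_iff_ae_notMem.1 ((countable_setOf_lt_of_interlaced (hle l i)).measure_zero μ)
  filter_upwards [hA, hnull i l, hnull l i] with v hv hil hli
  exact le_antisymm (not_lt.1 fun h => hli ⟨hv, h⟩) (not_lt.1 fun h => hil ⟨hv, h⟩)

end Efficiency

section Incentives

variable {μ : Measure ℝ} {p q b : ℝ → ℝ} {A : Set ℝ}

theorem setIntegral_Iio_sub {h : ℝ → ℝ} {s t : ℝ} (hst : s ≤ t) (hh : IntegrableOn h (Iio t) μ) :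
    ∫ y in Iio t, h y ∂μ - ∫ y in Iio s, h y ∂μ = ∫ y in Ico s t, h y ∂μ := by
  have hdisj : Disjoint (Iio s) (Ico s t) :=
    Set.disjoint_left.2 fun y hy hy' => hy'.1.not_gt hy
  rw [← Iio_union_Ico_eq_Iio hst, setIntegral_union hdisj measurableSet_Ico
    (hh.mono_set (Iio_subset_Iio hst)) (hh.mono_set Ico_subset_Iio_self), add_sub_cancel_left]

theorem exists_le_of_setIntegral_le {X : Type*} [MeasurableSpace X] {μ : Measure X}
    [IsFiniteMeasure μ] {s : Set X} (hs : 0 < μ s) {h₁ h₂ : X → ℝ} (hi₁ : IntegrableOn h₁ s μ)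
    (hi₂ : IntegrableOn h₂ s μ) (hle : ∫ x in s, h₁ x ∂μ ≤ ∫ x in s, h₂ x ∂μ) :
    ∃ x ∈ s, h₁ x ≤ h₂ x := by
  obtain ⟨x, hx, hxle⟩ := exists_le_setAverage hs.ne' (measure_ne_top μ s) (hi₁.sub hi₂)
  refine ⟨x, hx, sub_nonpos.1 (hxle.trans ?_)⟩
  rw [setAverage_eq, smul_eq_mul]
  simp only [Pi.sub_apply]
  rw [integral_sub hi₁ hi₂]
  exact mul_nonpos_of_nonneg_of_nonpos (inv_nonneg.2 measureReal_nonneg) (sub_nonpos.2 hle)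

theorem le_of_forall_exists_near {φ ψ : ℝ × ℝ → ℝ} (hφ : Continuous φ) (hψ : Continuous ψ) {v : ℝ}
    (h : ∀ ε > 0, ∃ t ∈ Metric.ball v ε, ∃ y ∈ Metric.ball v ε, φ (t, y) ≤ ψ (t, y)) :
    φ (v, v) ≤ ψ (v, v) := by
  have hmem : (v, v) ∈ closure {z | φ z ≤ ψ z} := by
    refine Metric.mem_closure_iff.2 fun ε hε => ?_
    obtain ⟨t, ht, y, hy, hle⟩ := h ε hε
    refine ⟨(t, y), hle, ?_⟩
    rw [Prod.dist_eq]
    exact max_lt (Metric.mem_ball'.1 ht) (Metric.mem_ball'.1 hy)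
  exact (isClosed_le hφ hψ).closure_subset hmem

/-- Imitating one another is not profitable for the values in `A`, when the value `t` wins the
quality `∫ y in Iio t, q y` for the payment `∫ y in Iio t, b y * p y`. -/
def IsIncentiveCompatible (μ : Measure ℝ) (A : Set ℝ) (p q b : ℝ → ℝ) : Prop :=
  ∀ v ∈ A, ∀ t ∈ A,
    v * ∫ y in Iio t, q y ∂μ - ∫ y in Iio t, b y * p y ∂μ ≤
      v * ∫ y in Iio v, q y ∂μ - ∫ y in Iio v, b y * p y ∂μ

theorem IsIncentiveCompatible.mul_setIntegral_le (hic : IsIncentiveCompatible μ A p q b)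
    (hq : Integrable q μ) {s t : ℝ} (hs : s ∈ A) (ht : t ∈ A) (hst : s ≤ t)
    (hbp : IntegrableOn (fun y => b y * p y) (Iio t) μ) :
    s * ∫ y in Ico s t, q y ∂μ ≤ ∫ y in Ico s t, b y * p y ∂μ ∧
      ∫ y in Ico s t, b y * p y ∂μ ≤ t * ∫ y in Ico s t, q y ∂μ := by
  rw [← setIntegral_Iio_sub hst hbp, ← setIntegral_Iio_sub hst hq.integrableOn]
  have hs' := hic s hs t ht
  have ht' := hic t ht s hs
  constructor <;> linarith

theorem mul_setIntegral_le_of_monotoneOn (hb : MonotoneOn b A) (hA : ∀ᵐ v ∂μ, v ∈ A)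
    (hp : Integrable p μ) (hp0 : ∀ y, 0 ≤ p y) {s t : ℝ} (hs : s ∈ A) (ht : t ∈ A)
    (hbp : IntegrableOn (fun y => b y * p y) (Iio t) μ) :
    b s * ∫ y in Ico s t, p y ∂μ ≤ ∫ y in Ico s t, b y * p y ∂μ ∧
      ∫ y in Ico s t, b y * p y ∂μ ≤ b t * ∫ y in Ico s t, p y ∂μ := by
  have hbp' := hbp.mono_set (Ico_subset_Iio_self : Ico s t ⊆ Iio t)
  have hAst : ∀ᵐ y ∂μ.restrict (Ico s t), y ∈ A ∧ y ∈ Ico s t :=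
    (ae_restrict_of_ae hA).and (ae_restrict_mem measurableSet_Ico)
  rw [← integral_const_mul, ← integral_const_mul]
  constructor
  · refine integral_mono_ae (hp.integrableOn.const_mul _) hbp' (hAst.mono fun y hy => ?_)
    exact mul_le_mul_of_nonneg_right (hb hs hy.1 hy.2.1) (hp0 y)
  · refine integral_mono_ae hbp' (hp.integrableOn.const_mul _) (hAst.mono fun y hy => ?_)
    exact mul_le_mul_of_nonneg_right (hb hy.1 ht hy.2.2.le) (hp0 y)

theorem IsIncentiveCompatible.exists_mem_Ico [IsFiniteMeasure μ]
    (hic : IsIncentiveCompatible μ A p q b) (hb : MonotoneOn b A) (hA : ∀ᵐ v ∂μ, v ∈ A)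
    (hp : Integrable p μ) (hp0 : ∀ y, 0 ≤ p y) (hq : Integrable q μ) {s t : ℝ} (hs : s ∈ A)
    (ht : t ∈ A) (hst : s ≤ t) (hμ : 0 < μ (Ico s t))
    (hbp : IntegrableOn (fun y => b y * p y) (Iio t) μ) :
    (∃ y ∈ Ico s t, b s * p y ≤ t * q y) ∧ ∃ y ∈ Ico s t, s * q y ≤ b t * p y := by
  obtain ⟨hq1, hq2⟩ := hic.mul_setIntegral_le hq hs ht hst hbp
  obtain ⟨hp1, hp2⟩ := mul_setIntegral_le_of_monotoneOn hb hA hp hp0 hs ht hbp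
  have hpi := fun c => hp.integrableOn (s := Ico s t) |>.const_mul c
  have hqi := fun c => hq.integrableOn (s := Ico s t) |>.const_mul c
  constructor
  · refine exists_le_of_setIntegral_le hμ (hpi _) (hqi _) ?_
    rw [integral_const_mul, integral_const_mul]
    exact hp1.trans hq2
  · refine exists_le_of_setIntegral_le hμ (hqi _) (hpi _) ?_
    rw [integral_const_mul, integral_const_mul]
    exact hq1.trans hp2

theorem IsIncentiveCompatible.mul_eq_mul [IsFiniteMeasure μ] {vbar : ℝ}
    (hsupp : μ.support = Icc 0 vbar) (hic : IsIncentiveCompatible μ A p q b)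
    (hb : MonotoneOn b A) (hA : ∀ᵐ v ∂μ, v ∈ A) (hAI : A ⊆ Ioo 0 vbar) (hp : Integrable p μ)
    (hpc : Continuous p) (hp0 : ∀ y, 0 ≤ p y) (hq : Integrable q μ) (hqc : Continuous q)
    (hbp : ∀ v ∈ A, IntegrableOn (fun y => b y * p y) (Iio v) μ) {v : ℝ} (hv : v ∈ A) :
    b v * p v = v * q v := by
  have hbounds : ∀ s ∈ A, ∀ t ∈ A, s < t →
      (∃ y ∈ Ico s t, b s * p y ≤ t * q y) ∧ ∃ y ∈ Ico s t, s * q y ≤ b t * p y :=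
    fun s hs t ht hst => hic.exists_mem_Ico hb hA hp hp0 hq hs ht hst.le
      ((measure_Ioo_pos hsupp (hAI hs).1.le hst (hAI ht).2.le).trans_le
        (measure_mono Ioo_subset_Ico_self)) (hbp t ht)
  have hbp_cont : Continuous fun z : ℝ × ℝ => b v * p z.2 := by fun_prop
  have htq_cont : Continuous fun z : ℝ × ℝ => z.1 * q z.2 := by fun_prop
  apply le_antisymm
  · refine le_of_forall_exists_near hbp_cont htq_cont fun ε hε => ?_
    obtain ⟨t, ⟨hvt, htε⟩, ht⟩ := exists_mem_Ioo_of_ae hsupp hA (a := v) (c := min (v + ε) vbar)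
      (hAI hv).1.le (lt_min (by linarith) (hAI hv).2) (min_le_right _ _)
    obtain ⟨y, hy, hle⟩ := (hbounds v hv t ht hvt).1
    have htε' := htε.trans_le (min_le_left _ _)
    rw [Real.ball_eq_Ioo]
    exact ⟨t, ⟨by linarith, htε'⟩, y, ⟨by linarith [hy.1], hy.2.trans htε'⟩, hle⟩
  · refine le_of_forall_exists_near htq_cont hbp_cont fun ε hε => ?_
    obtain ⟨s, ⟨hsε, hsv⟩, hs⟩ := exists_mem_Ioo_of_ae hsupp hA (a := max (v - ε) 0) (c := v)
      (le_max_right _ _) (max_lt (by linarith) (hAI hv).1) (hAI hv).2.le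
    obtain ⟨y, hy, hle⟩ := (hbounds s hs v hv hsv).2
    have hsε' := (le_max_left _ _).trans_lt hsε
    rw [Real.ball_eq_Ioo]
    exact ⟨s, ⟨hsε', by linarith⟩, y, ⟨hsε'.trans_le hy.1, by linarith [hy.2]⟩, hle⟩

end Incentives

section Necessity

variable {n k : ℕ} {μ : Measure ℝ} [IsProbabilityMeasure μ] [NullSingletonClass μ] {vbar : ℝ}
  {α β : Fin k → ℝ} {g : (Fin n → ℝ) → Equiv.Perm (Fin n)} {B : Fin n → ℝ → ℝ}

theorem eq_quantileBid_of_best_response (hk : 0 < k) (hkn : k < n) (hα : Antitone α)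
    (hα0 : ∀ j, 0 < α j) (hsupp : μ.support = Icc 0 vbar) (hg : IsAllocationRule g)
    {A : Set ℝ} (hA : ∀ᵐ v ∂μ, v ∈ A) (hAI : A ⊆ Ioo 0 vbar) {b : ℝ → ℝ} (hbm : Measurable b)
    (hb : StrictMonoOn b A) (hb0 : ∀ v ∈ A, 0 ≤ b v) (i : Fin n)
    (hbr : ∀ v ∈ A, ∀ x, 0 ≤ x → expectedUtility μ α β g (fun _ => b) i x v ≤
      expectedUtility μ α β g (fun _ => b) i (b v) v)
    {v : ℝ} (hv : v ∈ A) : b v = quantileBid μ n α β v := by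
  have hthr : ∀ t ∈ A, IsThreshold A b (b t) t := fun t ht => isThreshold_of_strictMonoOn hb ht
  have hic : IsIncentiveCompatible μ A (marginalQuality μ n α) (marginalQuality μ n β) b := by
    intro v hv t ht
    rw [← (hthr t ht).expectedUtility_eq hkn hg hA hbm hb hb0 i,
      ← (hthr v hv).expectedUtility_eq hkn hg hA hbm hb hb0 i]
    exact hbr v hv (b t) (hb0 t ht)
  have hpos := marginalQuality_pos hk hkn hα hα0 (cdf_mem_Ioo hsupp (hAI hv))
  rw [quantileBid, eq_div_iff hpos.ne']
  exact hic.mul_eq_mul hsupp hb.monotoneOn hA hAI (integrable_marginalQuality μ n α)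
    (continuous_marginalQuality μ n α) (marginalQuality_nonneg hkn hα hα0 μ)
    (integrable_marginalQuality μ n β) (continuous_marginalQuality μ n β)
    (fun t ht => integrableOn_mul_marginalQuality ((hthr t ht).integrableOn hA hbm hb0) n α) hv

theorem IsEfficientEquilibrium.exists_conull_eq_quantileBid
    (h : IsEfficientEquilibrium μ α β g B) (hk : 0 < k) (hkn : k < n) (hα : Antitone α)
    (hα0 : ∀ j, 0 < α j) (hβ0 : ∀ j, 0 < β j) (hsupp : μ.support = Icc 0 vbar)
    (hg : IsAllocationRule g) (i : Fin n) :
    ∃ A : Set ℝ, (∀ᵐ v ∂μ, v ∈ A) ∧ StrictMonoOn (B i) A ∧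
      ∀ v ∈ A, B i v = quantileBid μ n α β v := by
  obtain ⟨A₀, hA₀, hAI, hle⟩ := exists_conull_bid_le_bid hk hkn hβ0 hsupp hg h.efficient
  have hmono : StrictMonoOn (B i) A₀ :=
    strictMonoOn_of_bid_le_bid hk hkn hβ0 hsupp h.efficient hA₀ hAI hle i
  set A : Set ℝ := {v | v ∈ A₀ ∧ 0 ≤ B i v ∧ ∀ x, 0 ≤ x →
    expectedUtility μ α β g B i x v ≤ expectedUtility μ α β g B i (B i v) v}
  have hA : ∀ᵐ v ∂μ, v ∈ A := hA₀.and ((h.nonneg i).and (h.best_response i))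
  have hsymm := expectedUtility_congr (α := α) (β := β) (g := g)
    (fun l => ae_eq_of_bid_le_bid hA₀ hle l i) i
  refine ⟨A, hA, hmono.mono fun v hv => hv.1, fun v hv => ?_⟩
  refine eq_quantileBid_of_best_response hk hkn hα hα0 hsupp hg hA (fun v hv => hAI hv.1)
    (h.measurable i) (hmono.mono fun v hv => hv.1) (fun v hv => hv.2.1) i (fun v hv x hx => ?_) hv
  rw [← hsymm, ← hsymm]
  exact hv.2.2 x hx

theorem IsEfficientEquilibrium.ae_eq_quantileBid {B : Fin n → ℝ → ℝ}
    (h : IsEfficientEquilibrium μ α β g B) (hk : 0 < k) (hkn : k < n) (hα : Antitone α)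
    (hα0 : ∀ j, 0 < α j) (hβ0 : ∀ j, 0 < β j) (hsupp : μ.support = Icc 0 vbar)
    (hg : IsAllocationRule g) (i : Fin n) : B i =ᵐ[μ] quantileBid μ n α β := by
  obtain ⟨A, hA, -, heq⟩ := h.exists_conull_eq_quantileBid hk hkn hα hα0 hβ0 hsupp hg i
  filter_upwards [hA] with v hv using heq v hv

theorem IsEfficientEquilibrium.increasingAE_quantileBid {B : Fin n → ℝ → ℝ}
    (h : IsEfficientEquilibrium μ α β g B) (hk : 0 < k) (hkn : k < n) (hα : Antitone α)
    (hα0 : ∀ j, 0 < α j) (hβ0 : ∀ j, 0 < β j) (hsupp : μ.support = Icc 0 vbar)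
    (hg : IsAllocationRule g) : IncreasingAE μ (quantileBid μ n α β) := by
  obtain ⟨A, hA, hmono, heq⟩ :=
    h.exists_conull_eq_quantileBid hk hkn hα hα0 hβ0 hsupp hg ⟨0, hk.trans hkn⟩
  refine ⟨Aᶜ, mem_ae_iff.1 hA, ?_⟩
  rw [compl_compl]
  exact hmono.congr heq

end Necessity

section Optimality

variable {n k : ℕ} {α β : Fin k → ℝ} {g : (Fin n → ℝ) → Equiv.Perm (Fin n)} {b : ℝ → ℝ}
  {T : Set ℝ}

theorem isEfficient_of_sorted (hβ : Antitone β) (hβ0 : ∀ j, 0 < β j) {v : Fin n → ℝ}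
    {σ : Equiv.Perm (Fin n)} (h : ∀ i j, σ i < σ j → v j ≤ v i) : IsEfficient β v σ := by
  intro τ
  have hmono : Monovary (fun i => ext β (σ i)) v := fun i j hij =>
    antitone_ext hβ hβ0 (Fin.le_def.1 (not_lt.1 fun hσ => (h i j hσ).not_gt hij))
  simpa using hmono.sum_comp_perm_mul_le_sum_mul (σ := τ.trans σ.symm)

theorem isEfficient_of_strictMonoOn (hβ : Antitone β) (hβ0 : ∀ j, 0 < β j)
    (hg : IsAllocationRule g) (hb : StrictMonoOn b T) {v : Fin n → ℝ} (hv : ∀ i, v i ∈ T) :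
    IsEfficient β v (g fun i => b (v i)) :=
  isEfficient_of_sorted hβ hβ0 fun i j h =>
    (hb.le_iff_le (hv j) (hv i)).1 (hg.sorted (fun i => b (v i)) i j h)

theorem exists_isThreshold {a c : ℝ} (hb : StrictMonoOn b (Ioo a c)) (x : ℝ) :
    ∃ t, IsThreshold (Ioo a c) b x t := by
  set S : Set ℝ := insert a {y | y ∈ Ioo a c ∧ b y ≤ x}
  have hbdd : BddAbove S := BddAbove.insert a ⟨c, fun y hy => hy.1.2.le⟩
  refine ⟨sSup S, fun y hy => ⟨fun hlt => ?_, fun hlt => ?_⟩⟩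
  · obtain ⟨z, rfl | hz, hyz⟩ := exists_lt_of_lt_csSup ⟨a, mem_insert _ _⟩ hlt
    · exact absurd hyz hy.1.not_gt
    · exact (hb hy hz.1 hyz).trans_le hz.2
  · by_contra! hle
    exact (le_csSup hbdd (mem_insert_of_mem _ ⟨hy, hle⟩)).not_gt hlt

theorem setIntegral_Iio_sub_mul_le {μ : Measure ℝ} {q : ℝ → ℝ} (hq : ∀ y, 0 ≤ q y) {v t : ℝ}
    (ht : IntegrableOn (fun y => (v - y) * q y) (Iio t) μ)
    (hv : IntegrableOn (fun y => (v - y) * q y) (Iio v) μ) :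
    ∫ y in Iio t, (v - y) * q y ∂μ ≤ ∫ y in Iio v, (v - y) * q y ∂μ := by
  rw [← integral_indicator measurableSet_Iio, ← integral_indicator measurableSet_Iio]
  refine integral_mono (ht.integrable_indicator measurableSet_Iio)
    (hv.integrable_indicator measurableSet_Iio) fun y => ?_
  rcases lt_or_ge y v with hyv | hyv
  · have hnonneg : 0 ≤ (v - y) * q y := mul_nonneg (sub_nonneg.2 hyv.le) (hq y)
    rw [indicator_of_mem (mem_Iio.2 hyv)]
    exact indicator_apply_le' (fun _ => le_rfl) fun _ => hnonneg
  · have hnonpos : (v - y) * q y ≤ 0 := mul_nonpos_of_nonpos_of_nonneg (sub_nonpos.2 hyv) (hq y)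
    rw [indicator_of_notMem (s := Iio v) (notMem_Iio.2 hyv)]
    exact indicator_apply_le' (fun _ => hnonpos) fun _ => le_rfl

end Optimality

section Existence

variable {n k : ℕ} {μ : Measure ℝ} {vbar : ℝ} {α β : Fin k → ℝ}
  {g : (Fin n → ℝ) → Equiv.Perm (Fin n)} {b : ℝ → ℝ} {T : Set ℝ}

theorem quantileBid_zero (μ : Measure ℝ) (n : ℕ) (α β : Fin k → ℝ) : quantileBid μ n α β 0 = 0 := by
  rw [quantileBid, zero_mul, zero_div]

/-- The bidding function `quantileBid`, with its value at the largest valuation `vbar` replaced by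
the supremum over the smaller ones, so that it is increasing up to `vbar` when it is bounded. -/
def regularBid (μ : Measure ℝ) (n : ℕ) (α β : Fin k → ℝ) (vbar v : ℝ) : ℝ :=
  if v = vbar then sSup (quantileBid μ n α β '' Ioo 0 vbar) else quantileBid μ n α β v

theorem regularBid_of_ne {v : ℝ} (hv : v ≠ vbar) :
    regularBid μ n α β vbar v = quantileBid μ n α β v := if_neg hv

theorem regularBid_ae_eq_quantileBid [NullSingletonClass μ] :
    regularBid μ n α β vbar =ᵐ[μ] quantileBid μ n α β := by
  filter_upwards [Measure.ae_ne μ vbar] with v hv using regularBid_of_ne hv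

variable [IsProbabilityMeasure μ]

theorem quantileBid_pos (hk : 0 < k) (hkn : k < n) (hα : Antitone α) (hα0 : ∀ j, 0 < α j)
    (hβ : Antitone β) (hβ0 : ∀ j, 0 < β j) (hsupp : μ.support = Icc 0 vbar) {v : ℝ}
    (hv : v ∈ Ioo 0 vbar) : 0 < quantileBid μ n α β v :=
  div_pos (mul_pos hv.1 (marginalQuality_pos hk hkn hβ hβ0 (cdf_mem_Ioo hsupp hv)))
    (marginalQuality_pos hk hkn hα hα0 (cdf_mem_Ioo hsupp hv))

theorem continuousOn_quantileBid [NullSingletonClass μ] (hk : 0 < k) (hkn : k < n) (hα : Antitone α)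
    (hα0 : ∀ j, 0 < α j) (hsupp : μ.support = Icc 0 vbar) :
    ContinuousOn (quantileBid μ n α β) (Ioo 0 vbar) :=
  (continuous_id.mul (continuous_marginalQuality μ n β)).continuousOn.div
    (continuous_marginalQuality μ n α).continuousOn
    fun _ hv => (marginalQuality_pos hk hkn hα hα0 (cdf_mem_Ioo hsupp hv)).ne'

theorem IsThreshold.expectedUtility_eq_of_eqOn_quantileBid [NullSingletonClass μ] {x t : ℝ}
    (h : IsThreshold (Ioo 0 vbar) b x t) (hk : 0 < k) (hkn : k < n) (hα : Antitone α)
    (hα0 : ∀ j, 0 < α j) (hsupp : μ.support = Icc 0 vbar) (hg : IsAllocationRule g)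
    (hbm : Measurable b) (hb : StrictMonoOn b (Ioo 0 vbar)) (hb0 : ∀ v ∈ Ioo 0 vbar, 0 ≤ b v)
    (hbq : EqOn b (quantileBid μ n α β) (Ioo 0 vbar)) (i : Fin n) (v : ℝ) :
    IntegrableOn (fun y => (v - y) * marginalQuality μ n β y) (Iio t) μ ∧
      expectedUtility μ α β g (fun _ => b) i x v =
        ∫ y in Iio t, (v - y) * marginalQuality μ n β y ∂μ := by
  have hI := ae_mem_Ioo hsupp
  have hqi := ((integrable_marginalQuality μ n β).const_mul v).integrableOn (s := Iio t)
  have hpi := integrableOn_mul_marginalQuality (h.integrableOn hI hbm hb0) n α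
  have hvirtual : (fun y => v * marginalQuality μ n β y - b y * marginalQuality μ n α y)
      =ᵐ[μ.restrict (Iio t)] fun y => (v - y) * marginalQuality μ n β y := by
    filter_upwards [ae_restrict_of_ae hI] with y hy
    have hpos := marginalQuality_pos hk hkn hα hα0 (cdf_mem_Ioo hsupp hy)
    rw [hbq hy, quantileBid, div_mul_cancel₀ _ hpos.ne', sub_mul]
  refine ⟨(hqi.sub hpi).congr hvirtual, ?_⟩
  rw [h.expectedUtility_eq hkn hg hI hbm hb hb0 i, ← integral_const_mul, ← integral_sub hqi hpi]
  exact integral_congr_ae hvirtual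

theorem isEfficientEquilibriumOn_of_eqOn_quantileBid [NullSingletonClass μ] (hk : 0 < k)
    (hkn : k < n) (hα : Antitone α) (hα0 : ∀ j, 0 < α j) (hβ : Antitone β) (hβ0 : ∀ j, 0 < β j)
    (hsupp : μ.support = Icc 0 vbar) (hg : IsAllocationRule g) (hT : Ioo 0 vbar ⊆ T)
    (hbm : Measurable b) (hb : StrictMonoOn b T) (hb0 : ∀ v ∈ T, 0 ≤ b v)
    (hbq : EqOn b (quantileBid μ n α β) (Ioo 0 vbar)) : IsEfficientEquilibriumOn T μ α β g b where
  measurable := hbm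
  nonneg := hb0
  efficient _ hv := isEfficient_of_strictMonoOn hβ hβ0 hg hb hv
  best_response i v hv x _ := by
    have hbI := hb.mono hT
    obtain ⟨t, ht⟩ := exists_isThreshold hbI x
    have hv' := (isThreshold_of_strictMonoOn hb hv).mono hT
    obtain ⟨hti, hteq⟩ := ht.expectedUtility_eq_of_eqOn_quantileBid hk hkn hα hα0 hsupp hg hbm hbI
      (fun y hy => hb0 y (hT hy)) hbq i v
    obtain ⟨hvi, hveq⟩ := hv'.expectedUtility_eq_of_eqOn_quantileBid hk hkn hα hα0 hsupp hg hbm hbI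
      (fun y hy => hb0 y (hT hy)) hbq i v
    rw [hteq, hveq]
    exact setIntegral_Iio_sub_mul_le (marginalQuality_nonneg hkn hβ hβ0 μ) hti hvi

theorem IsEfficientEquilibriumOn.isEfficientEquilibrium (h : IsEfficientEquilibriumOn T μ α β g b)
    (hT : ∀ᵐ v ∂μ, v ∈ T) {b' : ℝ → ℝ} (hm : Measurable b') (hbb' : b =ᵐ[μ] b') :
    IsEfficientEquilibrium μ α β g fun _ => b' where
  measurable _ := hm
  nonneg _ := by
    filter_upwards [hT, hbb'] with v hv heq using heq ▸ h.nonneg v hv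
  efficient := by
    filter_upwards [ae_pi_of_ae fun _ : Fin n => hT.and hbb'] with v hv
    simp only [← (hv _).2]
    exact h.efficient v fun i => (hv i).1
  best_response i := by
    filter_upwards [hT, hbb'] with v hv heq x hx
    rw [← heq, ← expectedUtility_congr (fun _ => hbb'), ← expectedUtility_congr (fun _ => hbb')]
    exact h.best_response i v hv x hx

theorem measurable_regularBid [NullSingletonClass μ] :
    Measurable (regularBid μ n α β vbar) :=
  Measurable.ite (measurableSet_singleton vbar) measurable_const
    ((measurable_id.mul (continuous_marginalQuality μ n β).measurable).div
      (continuous_marginalQuality μ n α).measurable)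

theorem strictMonoOn_regularBid_Ico (hk : 0 < k) (hkn : k < n) (hα : Antitone α)
    (hα0 : ∀ j, 0 < α j) (hβ : Antitone β) (hβ0 : ∀ j, 0 < β j) (hsupp : μ.support = Icc 0 vbar)
    (hq : StrictMonoOn (quantileBid μ n α β) (Ioo 0 vbar)) :
    StrictMonoOn (regularBid μ n α β vbar) (Ico 0 vbar) := by
  intro x hx y hy hxy
  have hy' : y ∈ Ioo 0 vbar := ⟨hx.1.trans_lt hxy, hy.2⟩
  rw [regularBid_of_ne hx.2.ne, regularBid_of_ne hy.2.ne]
  rcases hx.1.eq_or_lt with rfl | hx0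
  · rw [quantileBid_zero]
    exact quantileBid_pos hk hkn hα hα0 hβ hβ0 hsupp hy'
  · exact hq ⟨hx0, hx.2⟩ hy' hxy

theorem strictMonoOn_regularBid_Icc (hk : 0 < k) (hkn : k < n) (hα : Antitone α)
    (hα0 : ∀ j, 0 < α j) (hβ : Antitone β) (hβ0 : ∀ j, 0 < β j) (hsupp : μ.support = Icc 0 vbar)
    (hq : StrictMonoOn (quantileBid μ n α β) (Ioo 0 vbar))
    (hbdd : BddAbove (quantileBid μ n α β '' Ioo 0 vbar)) :
    StrictMonoOn (regularBid μ n α β vbar) (Icc 0 vbar) := by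
  have hIco := strictMonoOn_regularBid_Ico hk hkn hα hα0 hβ hβ0 hsupp hq
  intro x hx y hy hxy
  rcases hy.2.eq_or_lt with rfl | hyv
  · obtain ⟨z, hxz, hzy⟩ := exists_between hxy
    have hz : z ∈ Ioo 0 y := ⟨hx.1.trans_lt hxz, hzy⟩
    refine (hIco ⟨hx.1, hxy⟩ ⟨hz.1.le, hz.2⟩ hxz).trans_le ?_
    rw [regularBid_of_ne hz.2.ne, regularBid, if_pos rfl]
    exact le_csSup hbdd (mem_image_of_mem _ hz)
  · exact hIco ⟨hx.1, hxy.trans hyv⟩ ⟨hy.1, hyv⟩ hxy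

theorem isEfficientEquilibriumOn_regularBid [NullSingletonClass μ] (hk : 0 < k) (hkn : k < n)
    (hα : Antitone α) (hα0 : ∀ j, 0 < α j) (hβ : Antitone β) (hβ0 : ∀ j, 0 < β j)
    (hsupp : μ.support = Icc 0 vbar) (hvbar : 0 < vbar) (hg : IsAllocationRule g)
    (hIco : Ico 0 vbar ⊆ T) (hT0 : ∀ v ∈ T, 0 ≤ v)
    (hT : StrictMonoOn (regularBid μ n α β vbar) T) :
    IsEfficientEquilibriumOn T μ α β g (regularBid μ n α β vbar) := by
  refine isEfficientEquilibriumOn_of_eqOn_quantileBid hk hkn hα hα0 hβ hβ0 hsupp hg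
    (Ioo_subset_Ico_self.trans hIco) measurable_regularBid hT (fun v hv => ?_)
    fun v hv => regularBid_of_ne hv.2.ne
  have h0v := hT.monotoneOn (hIco ⟨le_rfl, hvbar⟩) hv (hT0 v hv)
  rwa [regularBid_of_ne hvbar.ne, quantileBid_zero] at h0v

end Existence

end PositionAuction

end

open PositionAuction in
theorem lemma6 (n k : ℕ) (hk : 0 < k) (hkn : k < n)
    (α β : Fin k → ℝ) (hα : Antitone α) (hα0 : ∀ j, 0 < α j) (hβ : Antitone β) (hβ0 : ∀ j, 0 < β j)
    (vbar : ℝ) (hvbar : 0 < vbar)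
    (μ : Measure ℝ) [IsProbabilityMeasure μ]
    (f : ℝ → ℝ) (hf : Measurable f) (hf0 : ∀ v, 0 ≤ f v)
    (hμf : μ = volume.withDensity fun v => ENNReal.ofReal (f v))
    (hsupp : μ.support = Icc 0 vbar)
    (g : (Fin n → ℝ) → Equiv.Perm (Fin n)) (hg : IsAllocationRule g) :
    -- every efficient equilibrium uses the candidate bidding function
    (∀ b : Fin n → ℝ → ℝ, IsEfficientEquilibrium μ α β g b →
      ∀ i, b i =ᵐ[μ] candidateBid μ n α β) ∧
    -- if the candidate is increasing, then it is an efficient equilibrium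
    (IncreasingAE μ (candidateBid μ n α β) →
      IsEfficientEquilibrium μ α β g (fun _ => candidateBid μ n α β) ∧
      -- and it has a version without exceptional values, except possibly at `vbar`
      ∃ b : ℝ → ℝ, b =ᵐ[μ] candidateBid μ n α β ∧
        IsEfficientEquilibriumOn (Ico 0 vbar) μ α β g b ∧
        ((∃ C, ∀ᵐ v ∂μ, candidateBid μ n α β v ≤ C) →
          IsEfficientEquilibriumOn (Icc 0 vbar) μ α β g b)) ∧
    -- otherwise there is no efficient equilibrium
    (¬ IncreasingAE μ (candidateBid μ n α β) →
      ¬ ∃ b : Fin n → ℝ → ℝ, IsEfficientEquilibrium μ α β g b) ∧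
    -- the expected payment under a symmetric increasing profile of bidding functions
    (∀ b : ℝ → ℝ, Measurable b → (∀ᵐ v ∂μ, 0 ≤ b v) → IncreasingAE μ b →
      ∀ i, ∀ᵐ v ∂μ,
        (∀ s : Fin k, IntervalIntegrable (fun t => deriv (posProb μ n s) t * b t) volume 0 v) ∧
        expectedPayment μ α g (fun _ => b) i (b v) =
          ∑ s : Fin k, α s * ∫ t in (0 : ℝ)..v, deriv (posProb μ n s) t * b t) := by
  have : NullSingletonClass μ := hμf ▸ inferInstance
  have hI := ae_mem_Ioo hsupp
  have hcq := candidateBid_ae_eq_quantileBid hf hf0 hμf n α β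
  refine ⟨fun b hb i => ?_, fun hinc => ?_, fun hninc ⟨b, hb⟩ => hninc ?_, fun b hbm hb0 hb i => ?_⟩
  · exact (hb.ae_eq_quantileBid hk hkn hα hα0 hβ0 hsupp hg i).trans hcq.symm
  · have hq : StrictMonoOn (quantileBid μ n α β) (Ioo 0 vbar) :=
      (hinc.congr hcq).strictMonoOn_Ioo hsupp (continuousOn_quantileBid hk hkn hα hα0 hsupp)
    have hrc : regularBid μ n α β vbar =ᵐ[μ] candidateBid μ n α β :=
      regularBid_ae_eq_quantileBid.trans hcq.symm
    have hIco := isEfficientEquilibriumOn_regularBid hk hkn hα hα0 hβ hβ0 hsupp hvbar hg subset_rfl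
      (fun v hv => hv.1) (strictMonoOn_regularBid_Ico hk hkn hα hα0 hβ hβ0 hsupp hq)
    refine ⟨hIco.isEfficientEquilibrium (hI.mono fun v hv => Ioo_subset_Ico_self hv)
      (measurable_candidateBid μ n α β) hrc, _, hrc, hIco, fun ⟨C, hC⟩ => ?_⟩
    have hbdd := bddAbove_image_Ioo_of_ae_le hsupp hq.monotoneOn
      ((hcq.symm.le).trans hC : ∀ᵐ v ∂μ, quantileBid μ n α β v ≤ C)
    exact isEfficientEquilibriumOn_regularBid hk hkn hα hα0 hβ hβ0 hsupp hvbar hg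
      Ico_subset_Icc_self (fun v hv => hv.1)
      (strictMonoOn_regularBid_Icc hk hkn hα hα0 hβ hβ0 hsupp hq hbdd)
  · exact (hb.increasingAE_quantileBid hk hkn hα hα0 hβ0 hsupp hg).congr hcq.symm
  · exact ae_expectedPayment_eq hf hf0 hμf (hI.mono fun v hv => hv.1) hkn hg hbm hb0 hb i
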